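/- Let $d\in\{2,3\}$, let $\Omega\subset\mathbb R^d$ be open and bounded, $T>0$, and let $a,b\in\mathbb R$ and $c,L_1,L_2,L_3,M,A_0>0$ be constants. For $d\times d$ matrices write $A:B=\sum_{i,j}A_{ij}B_{ij}$, and put $$\mathcal F_B(Q)=\tfrac a2\operatorname{tr}(Q^2)-\tfrac b3\operatorname{tr}(Q^3)+\tfrac c4(\operatorname{tr}(Q^2))^2,\qquad r(Q)=\sqrt{2(\mathcal F_B(Q)+A_0)},$$ $$S(Q)=aQ-b\bigl[Q^2-\tfrac1d\operatorname{tr}(Q^2)I\bigr]+c\operatorname{tr}(Q^2)Q,\qquad P(Q)=\frac{S(Q)}{r(Q)},$$ where $A_0$ is such that $\mathcal F_B(Q)+A_0>0$ for all symmetric trace-free $Q$. Let $Q_0\in H^1_0(\Omega)^{d\times d}$ be symmetric and trace-free, and let $r_0=r(Q_0)$. Put $$e(Q,\varphi)=L_1\sum_{i,j}\nabla Q_{ij}\cdot\nabla\varphi_{ij}+\tfrac{L_2+L_3}2\sum_{i,j,k}\bigl(\partial_kQ_{jk}\,\partial_i\varphi_{ij}+\partial_kQ_{ik}\,\partial_j\varphi_{ij}-\tfrac2d\,\partial_iQ_{ki}\,\partial_k\varphi_{jj}\bigr).$$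 For a matrix field $R$ on $(0,T)\times\Omega$ consider the equation $$(\mathrm{E}_R)\qquad \int_0^T\!\!\int_\Omega Q:\partial_t\varphi-\int_\Omega Q(T):\varphi(T)+\int_\Omega Q_0:\varphi(0)=M\int_0^T\!\!\int_\Omega e(Q,\varphi)+M\int_0^T\!\!\int_\Omega R:\varphi$$ for all smooth $\varphi$ with values in $\mathbb R^{d\times d}$ and compact support in $[0,T]\times\Omega$, and let $H_R\in L^2((0,T)\times\Omega)$ be the field with $\int_0^T\!\int_\Omega H_R:\varphi=-\int_0^T\!\int_\Omega e(Q,\varphi)-\int_0^T\!\int_\Omega R:\varphi$ for all smooth $\varphi$ with compact support in $(0,T)\times\Omega$. *Reformulated system.* A pair $Q:[0,T]\times\Omega\to\mathbb R^{d\times d}$, $g:[0,T]\times\Omega\to\mathbb R$ with $Q$ symmetric and trace-free is a weak solution if $Q\in L^\infty(0,T;H^1(\Omega))$, $Q_t\in L^2((0,T)\times\Omega)$, $g\in L^\infty(0,T;L^2(\Omega))$, $(\mathrm E_R)$ holds with $R=g\,P(Q)$, $$\int_0^T\!\!\int_\Omega g\,\phi_t-\int_\Omega g(T)\phi(T)+\int_\Omega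 r_0\,\phi(0)=-\int_0^T\!\!\int_\Omega P(Q):Q_t\,\phi$$ for all smooth real $\phi$ with compact support in $[0,T]\times\Omega$, and for a.e. $t\in[0,T]$ $$\tfrac12\int_\Omega L_1|\nabla Q(t)|^2+(L_2+L_3)|\operatorname{div}Q(t)|^2+g(t)^2\le\tfrac12\int_\Omega L_1|\nabla Q_0|^2+(L_2+L_3)|\operatorname{div}Q_0|^2+r_0^2-M\int_0^t\!\!\int_\Omega|H_R|^2 .$$ *Q-tensor flow.* A symmetric trace-free $Q:[0,T]\times\Omega\to\mathbb R^{d\times d}$ is a weak solution of the Q-tensor flow if $Q\in L^\infty(0,T;H^1(\Omega))$, $Q_t\in L^2((0,T)\times\Omega)$, $(\mathrm E_R)$ holds with $R=S(Q)$, and for every $t\in[0,T]$ one has $Q(t)\in H^1(\Omega)$, $\mathcal F_B(Q(t))\in L^1(\Omega)$ and $$\tfrac12\int_\Omega L_1|\nabla Q(t)|^2+(L_2+L_3)|\operatorname{div}Q(t)|^2+2\mathcal F_B(Q(t))\le\tfrac12\int_\Omega L_1|\nabla Q_0|^2+(L_2+L_3)|\operatorname{div}Q_0|^2+2\mathcal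 F_B(Q_0)-M\int_0^t\!\!\int_\Omega|H_R|^2 .$$ **Lemma.** Let $(Q,g)$ be a weak solution of the reformulated system. Then for every smooth $\psi$ with compact support in $(0,T)\times\Omega$, $$\int_0^T\!\!\int_\Omega g\,\psi\,dx\,dt=\int_0^T\!\!\int_\Omega r(Q)\,\psi\,dx\,dt .$$ Consequently $Q$ is a weak solution of the Q-tensor flow, where, as usual, $Q$ is identified with its representative that is continuous in time: $Q$ agrees a.e. on $(0,T)\times\Omega$ with a symmetric trace-free $Q'\in C([0,T];L^2(\Omega))$, and every such $Q'$ is a weak solution of the Q-tensor flow. -/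

import Mathlib

open MeasureTheory Set Filter Topology
open scoped ContDiff

noncomputable section

namespace QTensor

/-- Physical space `ℝ^d` with the Euclidean norm and Lebesgue measure. -/
abbrev Space (d : ℕ) := EuclideanSpace ℝ (Fin d)

abbrev Mat (d : ℕ) := Matrix (Fin d) (Fin d) ℝ

variable {d : ℕ}

/-! ### Matrices, the bulk potential and its derived functions -/

/-- The product `A : B = ∑ A_ij B_ij`. -/
def dot (A B : Mat d) : ℝ := ∑ i, ∑ j, A i j * B i j

def SymTraceFree (A : Mat d) : Prop := A.IsSymm ∧ A.trace = 0

/-- The constants of the model. -/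
structure Params where
  a : ℝ
  b : ℝ
  c : ℝ
  L₁ : ℝ
  L₂ : ℝ
  L₃ : ℝ
  M : ℝ
  A₀ : ℝ

/-- The bulk potential `F_B`. -/
def bulk (p : Params) (Q : Mat d) : ℝ :=
  p.a / 2 * (Q ^ 2).trace - p.b / 3 * (Q ^ 3).trace + p.c / 4 * ((Q ^ 2).trace) ^ 2

/-- `r(Q) = √(2 (F_B(Q) + A₀))`. -/
def rFun (p : Params) (Q : Mat d) : ℝ := Real.sqrt (2 * (bulk p Q + p.A₀))

def S (p : Params) (Q : Mat d) : Mat d :=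
  p.a • Q - p.b • (Q ^ 2 - ((1 / (d : ℝ)) * (Q ^ 2).trace) • (1 : Mat d))
    + (p.c * (Q ^ 2).trace) • Q

def P (p : Params) (Q : Mat d) : Mat d := (rFun p Q)⁻¹ • S p Q

/-- The sign conditions on the constants; `A₀` is such that `r` is positive on symmetric
trace-free matrices. -/
structure Params.Admissible (p : Params) (d : ℕ) : Prop where
  c_pos : 0 < p.c
  L₁_pos : 0 < p.L₁
  L₂_pos : 0 < p.L₂
  L₃_pos : 0 < p.L₃
  M_pos : 0 < p.M
  A₀_pos : 0 < p.A₀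
  r_pos : ∀ Q : Mat d, SymTraceFree Q → 0 < bulk p Q + p.A₀

/-! ### Test functions and weak derivatives -/

/-- The partial derivative `∂_k u`. -/
def pd (k : Fin d) (u : Space d → ℝ) (x : Space d) : ℝ :=
  fderiv ℝ u x (EuclideanSpace.single k 1)

/-- The time derivative `∂_t φ`. -/
def td (φ : ℝ → Space d → ℝ) (t : ℝ) (x : Space d) : ℝ := deriv (fun s => φ s x) t

/-- The entrywise time derivative of a matrix-valued function. -/
def tdMat (φ : ℝ → Space d → Mat d) (t : ℝ) (x : Space d) : Mat d :=
  Matrix.of fun i j => td (fun s y => φ s y i j) t x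

/-- `C_c^∞(Ω)`. -/
def IsTest (Ω : Set (Space d)) (φ : Space d → ℝ) : Prop :=
  ContDiff ℝ ∞ φ ∧ HasCompactSupport φ ∧ tsupport φ ⊆ Ω

/-- `C_c^∞(U)` for `U` in space-time. With `U = (0,T) × Ω` the functions vanish near the
initial and the final time; with `U = ℝ × Ω` their restrictions to `[0,T] × Ω` are the smooth
functions with compact support in `[0,T] × Ω`, which need not vanish at times `0` and `T`. -/
def IsTestST (U : Set (ℝ × Space d)) (φ : ℝ → Space d → ℝ) : Prop :=
  ContDiff ℝ ∞ (fun q : ℝ × Space d => φ q.1 q.2) ∧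
    HasCompactSupport (fun q : ℝ × Space d => φ q.1 q.2) ∧
    tsupport (fun q : ℝ × Space d => φ q.1 q.2) ⊆ U

def IsTestSTMat (U : Set (ℝ × Space d)) (φ : ℝ → Space d → Mat d) : Prop :=
  ∀ i j, IsTestST U (fun t x => φ t x i j)

/-- `A ∈ H^1(Ω)^{d×d}` with weak partial derivatives `∂_k A = G k`. -/
structure HasH1Gradient (Ω : Set (Space d)) (A : Space d → Mat d)
    (G : Fin d → Space d → Mat d) : Prop where
  memLp : ∀ i j, MemLp (fun x => A x i j) 2 (volume.restrict Ω)
  memLp_grad : ∀ k i j, MemLp (fun x => G k x i j) 2 (volume.restrict Ω)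
  weak : ∀ k i j, ∀ φ : Space d → ℝ, IsTest Ω φ →
    ∫ x in Ω, A x i j * pd k φ x = -∫ x in Ω, G k x i j * φ x

/-- `|∇A|² = ∑_k |∂_k A|²`. -/
def gradSq (G : Fin d → Space d → Mat d) (x : Space d) : ℝ := ∑ k, dot (G k x) (G k x)

/-- `|div A|²`, where `(div A)_j = ∑_i ∂_i A_ij`. -/
def divSq (G : Fin d → Space d → Mat d) (x : Space d) : ℝ := ∑ j, (∑ i, G i x i j) ^ 2

/-- `A ∈ H^1_0(Ω)^{d×d}` (zero boundary values), with weak gradient `G`: the closure of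
`C_c^∞(Ω)` in `H^1(Ω)`. -/
def HasH10Gradient (Ω : Set (Space d)) (A : Space d → Mat d)
    (G : Fin d → Space d → Mat d) : Prop :=
  HasH1Gradient Ω A G ∧
    ∀ ε > 0, ∃ φ : Space d → Mat d, (∀ i j, IsTest Ω (fun x => φ x i j)) ∧
      ∫ x in Ω, (dot (A x - φ x) (A x - φ x)
        + gradSq (fun k y => G k y - Matrix.of fun i j => pd k (fun z => φ z i j) y) x) < ε

/-- `Q ∈ L^∞(0,T; H^1(Ω))` with weak spatial gradient `DQ`, `DQ t k = ∂_k Q(t)`. -/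
structure IsLinftyH1 (Ω : Set (Space d)) (T : ℝ) (Q : ℝ → Space d → Mat d)
    (DQ : ℝ → Fin d → Space d → Mat d) : Prop where
  meas : ∀ i j, AEStronglyMeasurable (fun q : ℝ × Space d => Q q.1 q.2 i j)
    (volume.restrict (Ioo 0 T ×ˢ Ω))
  meas_grad : ∀ k i j, AEStronglyMeasurable (fun q : ℝ × Space d => DQ q.1 k q.2 i j)
    (volume.restrict (Ioo 0 T ×ˢ Ω))
  bound : ∃ C : ℝ, ∀ᵐ t ∂(volume.restrict (Ioo 0 T)), HasH1Gradient Ω (Q t) (DQ t) ∧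
    ∫ x in Ω, (dot (Q t x) (Q t x) + gradSq (DQ t) x) ≤ C

/-- `r ∈ L^∞(0,T; L^2(Ω))`. -/
structure IsLinftyL2 (Ω : Set (Space d)) (T : ℝ) (r : ℝ → Space d → ℝ) : Prop where
  meas : AEStronglyMeasurable (fun q : ℝ × Space d => r q.1 q.2)
    (volume.restrict (Ioo 0 T ×ˢ Ω))
  bound : ∃ C : ℝ, ∀ᵐ t ∂(volume.restrict (Ioo 0 T)),
    MemLp (r t) 2 (volume.restrict Ω) ∧ ∫ x in Ω, (r t x) ^ 2 ≤ C

/-- `H ∈ L^2((0,T) × Ω)^{d×d}`. -/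
def IsL2ST (Ω : Set (Space d)) (T : ℝ) (H : ℝ → Space d → Mat d) : Prop :=
  ∀ i j, MemLp (fun q : ℝ × Space d => H q.1 q.2 i j) 2 (volume.restrict (Ioo 0 T ×ˢ Ω))

/-- `Qt` is the weak time derivative of `Q` and lies in `L^2((0,T) × Ω)`. -/
structure HasL2TimeDeriv (Ω : Set (Space d)) (T : ℝ) (Q Qt : ℝ → Space d → Mat d) : Prop where
  memLp : IsL2ST Ω T Qt
  weak : ∀ i j, ∀ ψ : ℝ → Space d → ℝ, IsTestST (Ioo 0 T ×ˢ Ω) ψ →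
    ∫ q in Ioo 0 T ×ˢ Ω, Q q.1 q.2 i j * td ψ q.1 q.2
      = -∫ q in Ioo 0 T ×ˢ Ω, Qt q.1 q.2 i j * ψ q.1 q.2

/-! ### The two weak formulations -/

/-- The density of the elastic bilinear form, obtained from
`-(L₁ ΔQ + (L₂+L₃)/2 α(Q)) : φ` by integration by parts. -/
def elastic (p : Params) (DQ : ℝ → Fin d → Space d → Mat d) (φ : ℝ → Space d → Mat d)
    (t : ℝ) (x : Space d) : ℝ :=
  p.L₁ * (∑ i, ∑ j, ∑ k, DQ t k x i j * pd k (fun y => φ t y i j) x)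
    + (p.L₂ + p.L₃) / 2 * (∑ i, ∑ j, ∑ k,
        (DQ t k x j k * pd i (fun y => φ t y i j) x
          + DQ t k x i k * pd j (fun y => φ t y i j) x
          - 2 / (d : ℝ) * (DQ t i x k i * pd k (fun y => φ t y j j) x)))

/-- `H = L₁ ΔQ + (L₂+L₃)/2 α(Q) - R` in the sense of distributions on `(0,T) × Ω`, with
`H ∈ L^2((0,T) × Ω)`. -/
structure IsDriving (p : Params) (Ω : Set (Space d)) (T : ℝ)
    (DQ : ℝ → Fin d → Space d → Mat d) (R H : ℝ → Space d → Mat d) : Prop where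
  memLp : IsL2ST Ω T H
  weak : ∀ φ : ℝ → Space d → Mat d, IsTestSTMat (Ioo 0 T ×ˢ Ω) φ →
    ∫ q in Ioo 0 T ×ˢ Ω, dot (H q.1 q.2) (φ q.1 q.2)
      = -(∫ q in Ioo 0 T ×ˢ Ω, elastic p DQ φ q.1 q.2)
        - ∫ q in Ioo 0 T ×ˢ Ω, dot (R q.1 q.2) (φ q.1 q.2)

/-- The weak form, with initial value `Q₀`, of `Q_t = M (L₁ ΔQ + (L₂+L₃)/2 α(Q) - R)`,
tested with smooth functions of compact support in `[0,T] × Ω`. -/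
def WeakQEquation (p : Params) (Ω : Set (Space d)) (T : ℝ) (Q₀ : Space d → Mat d)
    (Q : ℝ → Space d → Mat d) (DQ : ℝ → Fin d → Space d → Mat d)
    (R : ℝ → Space d → Mat d) : Prop :=
  ∀ φ : ℝ → Space d → Mat d, IsTestSTMat (univ ×ˢ Ω) φ →
    (∫ q in Ioo 0 T ×ˢ Ω, dot (Q q.1 q.2) (tdMat φ q.1 q.2))
        - (∫ x in Ω, dot (Q T x) (φ T x)) + (∫ x in Ω, dot (Q₀ x) (φ 0 x))
      = p.M * (∫ q in Ioo 0 T ×ˢ Ω, elastic p DQ φ q.1 q.2)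
        + p.M * (∫ q in Ioo 0 T ×ˢ Ω, dot (R q.1 q.2) (φ q.1 q.2))

/-- The conditions on `(Q, r)` in the weak formulation of the reformulated system, given the
weak gradient `DQ`, the weak time derivative `Qt` and the field `H`. Here `DQ₀` is the weak
gradient of `Q₀`. -/
structure ReformulatedData (p : Params) (Ω : Set (Space d)) (T : ℝ) (Q₀ : Space d → Mat d)
    (DQ₀ : Fin d → Space d → Mat d) (Q : ℝ → Space d → Mat d) (r : ℝ → Space d → ℝ)
    (DQ : ℝ → Fin d → Space d → Mat d) (Qt H : ℝ → Space d → Mat d) : Prop where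
  symTraceFree : ∀ t ∈ Icc 0 T, ∀ x ∈ Ω, SymTraceFree (Q t x)
  linftyH1 : IsLinftyH1 Ω T Q DQ
  timeDeriv : HasL2TimeDeriv Ω T Q Qt
  linftyL2 : IsLinftyL2 Ω T r
  /-- The values at time `T` that enter the equations can be tested. -/
  final_Q : ∀ i j, LocallyIntegrableOn (fun x => Q T x i j) Ω
  final_r : LocallyIntegrableOn (r T) Ω
  equation_Q : WeakQEquation p Ω T Q₀ Q DQ (fun t x => r t x • P p (Q t x))
  equation_r : ∀ φ : ℝ → Space d → ℝ, IsTestST (univ ×ˢ Ω) φ →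
    (∫ q in Ioo 0 T ×ˢ Ω, r q.1 q.2 * td φ q.1 q.2)
        - (∫ x in Ω, r T x * φ T x) + (∫ x in Ω, rFun p (Q₀ x) * φ 0 x)
      = -∫ q in Ioo 0 T ×ˢ Ω, dot (P p (Q q.1 q.2)) (Qt q.1 q.2) * φ q.1 q.2
  driving : IsDriving p Ω T DQ (fun t x => r t x • P p (Q t x)) H
  energy : ∀ᵐ t ∂(volume.restrict (Ioo 0 T)),
    1 / 2 * (∫ x in Ω, (p.L₁ * gradSq (DQ t) x + (p.L₂ + p.L₃) * divSq (DQ t) x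
        + (r t x) ^ 2))
      ≤ 1 / 2 * (∫ x in Ω, (p.L₁ * gradSq DQ₀ x + (p.L₂ + p.L₃) * divSq DQ₀ x
          + (rFun p (Q₀ x)) ^ 2))
        - p.M * ∫ q in Ioo 0 t ×ˢ Ω, dot (H q.1 q.2) (H q.1 q.2)

/-- `(Q, r)` is a weak solution of the reformulated system
`Q_t = M (L₁ ΔQ + (L₂+L₃)/2 α(Q) - r P(Q)) = M H`, `r_t = P(Q) : Q_t`
with initial values `Q₀` and `r(Q₀)`. -/
def IsWeakSolutionReformulated (p : Params) (Ω : Set (Space d)) (T : ℝ)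
    (Q₀ : Space d → Mat d) (DQ₀ : Fin d → Space d → Mat d)
    (Q : ℝ → Space d → Mat d) (r : ℝ → Space d → ℝ) : Prop :=
  ∃ DQ Qt H, ReformulatedData p Ω T Q₀ DQ₀ Q r DQ Qt H

/-- The conditions on `Q` in the weak formulation of the Q-tensor flow, given the weak gradient
`DQ`, the weak time derivative `Qt` and the field `H`. -/
structure FlowData (p : Params) (Ω : Set (Space d)) (T : ℝ) (Q₀ : Space d → Mat d)
    (DQ₀ : Fin d → Space d → Mat d) (Q : ℝ → Space d → Mat d)
    (DQ : ℝ → Fin d → Space d → Mat d) (Qt H : ℝ → Space d → Mat d) : Prop where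
  symTraceFree : ∀ t ∈ Icc 0 T, ∀ x ∈ Ω, SymTraceFree (Q t x)
  linftyH1 : IsLinftyH1 Ω T Q DQ
  timeDeriv : HasL2TimeDeriv Ω T Q Qt
  integrable_reaction : ∀ φ : ℝ → Space d → Mat d, IsTestSTMat (univ ×ˢ Ω) φ →
    IntegrableOn (fun q : ℝ × Space d => dot (S p (Q q.1 q.2)) (φ q.1 q.2)) (Ioo 0 T ×ˢ Ω)
  equation : WeakQEquation p Ω T Q₀ Q DQ (fun t x => S p (Q t x))
  driving : IsDriving p Ω T DQ (fun t x => S p (Q t x)) H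
  /-- At every time, including `0` and `T`, the energy is well defined and bounded. -/
  energy : ∀ t ∈ Icc 0 T, HasH1Gradient Ω (Q t) (DQ t) ∧
    IntegrableOn (fun x => bulk p (Q t x)) Ω ∧
    1 / 2 * (∫ x in Ω, (p.L₁ * gradSq (DQ t) x + (p.L₂ + p.L₃) * divSq (DQ t) x
        + 2 * bulk p (Q t x)))
      ≤ 1 / 2 * (∫ x in Ω, (p.L₁ * gradSq DQ₀ x + (p.L₂ + p.L₃) * divSq DQ₀ x
          + 2 * bulk p (Q₀ x)))
        - p.M * ∫ q in Ioo 0 t ×ˢ Ω, dot (H q.1 q.2) (H q.1 q.2)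

/-- `Q` is a weak solution of the Q-tensor flow
`Q_t = M (L₁ ΔQ + (L₂+L₃)/2 α(Q) - S(Q)) = M H` with initial value `Q₀`. -/
def IsWeakSolutionFlow (p : Params) (Ω : Set (Space d)) (T : ℝ)
    (Q₀ : Space d → Mat d) (DQ₀ : Fin d → Space d → Mat d) (Q : ℝ → Space d → Mat d) : Prop :=
  ∃ DQ Qt H, FlowData p Ω T Q₀ DQ₀ Q DQ Qt H

/-- `Q'` is a representative of the class of `Q` modulo null sets of `(0,T) × Ω` that takes
symmetric trace-free values and is continuous in time with values in `L^2(Ω)`; it gives a meaning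
to the value of `Q` at every single time. -/
structure IsContinuousRepresentative (Ω : Set (Space d)) (T : ℝ)
    (Q Q' : ℝ → Space d → Mat d) : Prop where
  ae_eq : ∀ᵐ q ∂((volume : Measure (ℝ × Space d)).restrict (Ioo 0 T ×ˢ Ω)),
    Q' q.1 q.2 = Q q.1 q.2
  symTraceFree : ∀ t ∈ Icc 0 T, ∀ x ∈ Ω, SymTraceFree (Q' t x)
  memLp : ∀ t ∈ Icc 0 T, ∀ i j, MemLp (fun x => Q' t x i j) 2 (volume.restrict Ω)
  continuous : ∀ s ∈ Icc 0 T,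
    Tendsto (fun t => ∫ x in Ω, dot (Q' t x - Q' s x) (Q' t x - Q' s x))
      (𝓝[Icc 0 T] s) (𝓝 0)

end QTensor

end

open QTensor

noncomputable section

namespace QTensor

variable {d : ℕ}

/-! ### Algebra and growth of the bulk potential -/

/-! The identity `g = r(Q)` is a chain rule. The auxiliary variable satisfies `g_t = P(Q) : Q_t`
weakly with initial value `r(Q₀)`. Along an absolutely continuous curve of symmetric trace-free
matrices, `r(v)` has the derivative `P(v) : v'`, because the gradient of the bulk potential differs
from `S` by a multiple of the identity, which is orthogonal to trace-free directions. Since `Q_t` is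
in `L²`, for a.e. `x` the curve `t ↦ Q(t,x)` agrees a.e. with the absolutely continuous primitive
`Q₀ + ∫ Q_t` (`timePrimitive`, `Q_eq_timePrimitive`). Hence `g` and `r(Q)` are primitives of the
same function with the same initial value (`rFun_eq_integral`,
`eq_primitive_of_forall_integral_test`, `r_eq_rFun`).

Integrability needs no Sobolev embedding. The potential plus `A₀` is bounded below by a positive
multiple of `(1+|Q|)⁴` (`exists_bulk_lower_bound`), so `P` grows at most linearly
(`exists_P_bound`). Thus `P(Q)` is in `L²`, and both `P(Q) : Q_t` and `g P(Q)` are integrable. The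
potential is integrable in space because it is `g²/2 - A₀`.

Given the identity, `g P(Q) = S(Q)` turns one equation into the other, and `g² = 2(F_B(Q) + A₀)`
gives the energy inequality at a.e. time; the constant `A₀` contributes equally to both sides. To
reach an arbitrary time `t`, good times `τ n → t` are taken: the gradients converge weakly in `L²`
along an ultrafilter, the elastic energy is weakly lower semicontinuous, Fatou's lemma handles the
potential, and the dissipation is continuous in time (`exists_energyAt`). Lower semicontinuity is
phrased through convergent minorants, so that the several terms can simply be added. Finally, any
representative continuous in `L²` equals the primitive at every time (`representative_eq`), so the
conclusions transfer to it. -/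

/-- The Frobenius norm `|A| = (A : A)^{1/2}`. -/
def frob (A : Mat d) : ℝ := Real.sqrt (dot A A)

lemma dot_self_nonneg (A : Mat d) : 0 ≤ dot A A :=
  Finset.sum_nonneg fun _ _ => Finset.sum_nonneg fun _ _ => mul_self_nonneg _

lemma frob_nonneg (A : Mat d) : 0 ≤ frob A := Real.sqrt_nonneg _

lemma frob_sq (A : Mat d) : frob A ^ 2 = dot A A := Real.sq_sqrt (dot_self_nonneg A)

lemma sq_entry_le_dot_self (A : Mat d) (i j : Fin d) : A i j ^ 2 ≤ dot A A := by
  have h1 : A i j ^ 2 ≤ ∑ l, A i l * A i l := by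
    rw [sq]
    exact Finset.single_le_sum (f := fun l => A i l * A i l) (fun _ _ => mul_self_nonneg _)
      (Finset.mem_univ j)
  exact h1.trans (Finset.single_le_sum (f := fun k => ∑ l, A k l * A k l)
    (fun _ _ => Finset.sum_nonneg fun _ _ => mul_self_nonneg _) (Finset.mem_univ i))

lemma abs_entry_le_frob (A : Mat d) (i j : Fin d) : |A i j| ≤ frob A := by
  rw [← Real.sqrt_sq_eq_abs]
  exact Real.sqrt_le_sqrt (sq_entry_le_dot_self A i j)

lemma frob_le_sum_abs (A : Mat d) : frob A ≤ ∑ i, ∑ j, |A i j| := by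
  refine Real.sqrt_le_iff.2 ⟨by positivity, ?_⟩
  have h1 : ∀ i, ∑ j, A i j * A i j ≤ (∑ j, |A i j|) ^ 2 := fun i => by
    have := Finset.sum_sq_le_sq_sum_of_nonneg (s := Finset.univ) (f := fun j => |A i j|)
      (fun _ _ => abs_nonneg _)
    simpa [sq] using this
  have h2 := Finset.sum_sq_le_sq_sum_of_nonneg (s := Finset.univ) (f := fun i => ∑ j, |A i j|)
      (fun _ _ => by positivity)
  exact (Finset.sum_le_sum fun i _ => h1 i).trans h2

lemma trace_sq_eq_sum (A : Mat d) : (A ^ 2).trace = ∑ i, ∑ j, A i j * A j i := by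
  simp [sq, Matrix.trace, Matrix.mul_apply]

lemma trace_cube_eq_sum (A : Mat d) :
    (A ^ 3).trace = ∑ i, ∑ j, ∑ k, A i j * A j k * A k i := by
  simp only [pow_succ, pow_zero, one_mul, Matrix.trace, Matrix.mul_apply, Matrix.diag_apply,
    Finset.sum_mul]
  exact Finset.sum_congr rfl fun i _ => Finset.sum_comm

lemma trace_sq_of_isSymm {A : Mat d} (hA : A.IsSymm) : (A ^ 2).trace = frob A ^ 2 := by
  rw [trace_sq_eq_sum, frob_sq, dot]
  simp_rw [hA.apply]

lemma abs_trace_cube_le (A : Mat d) : |(A ^ 3).trace| ≤ (d : ℝ) ^ 3 * frob A ^ 3 := by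
  rw [trace_cube_eq_sum]
  have h : ∀ i j k, |A i j * A j k * A k i| ≤ frob A ^ 3 := fun i j k => by
    rw [abs_mul, abs_mul, pow_succ, sq]
    have := frob_nonneg A
    gcongr <;> exact abs_entry_le_frob A _ _
  calc |∑ i, ∑ j, ∑ k, A i j * A j k * A k i|
      ≤ ∑ i, ∑ j, ∑ k, |A i j * A j k * A k i| :=
        (Finset.abs_sum_le_sum_abs _ _).trans (Finset.sum_le_sum fun i _ =>
          (Finset.abs_sum_le_sum_abs _ _).trans (Finset.sum_le_sum fun j _ =>
            Finset.abs_sum_le_sum_abs _ _))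
    _ ≤ ∑ _i : Fin d, ∑ _j : Fin d, ∑ _k : Fin d, frob A ^ 3 :=
        Finset.sum_le_sum fun i _ => Finset.sum_le_sum fun j _ => Finset.sum_le_sum fun k _ =>
          h i j k
    _ = (d : ℝ) ^ 3 * frob A ^ 3 := by simp; ring

lemma continuous_dot_self : Continuous fun A : Mat d => dot A A := by
  unfold dot; fun_prop

lemma continuous_bulk (p : Params) : Continuous (bulk p : Mat d → ℝ) := by
  have h2 : Continuous fun A : Mat d => (A ^ 2).trace := (continuous_pow 2).matrix_trace
  have h3 : Continuous fun A : Mat d => (A ^ 3).trace := (continuous_pow 3).matrix_trace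
  unfold bulk; fun_prop

lemma continuous_rFun (p : Params) : Continuous (rFun p : Mat d → ℝ) :=
  Real.continuous_sqrt.comp (((continuous_bulk p).add continuous_const).const_mul 2)

lemma continuous_S (p : Params) : Continuous (S p : Mat d → Mat d) := by
  have h2 : Continuous fun A : Mat d => (A ^ 2).trace := (continuous_pow 2).matrix_trace
  have h3 : Continuous fun A : Mat d => A ^ 2 := continuous_pow 2
  unfold S; fun_prop

lemma isClosed_symTraceFree : IsClosed {A : Mat d | SymTraceFree A} := by
  refine IsClosed.inter ?_ ?_
  · exact isClosed_eq continuous_id.matrix_transpose continuous_id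
  · exact isClosed_eq continuous_id.matrix_trace continuous_const

lemma isCompact_symTraceFree_frob_le (N : ℝ) :
    IsCompact {A : Mat d | SymTraceFree A ∧ frob A ≤ N} := by
  have hK : IsCompact (Set.pi univ fun _ : Fin d => Set.pi univ fun _ : Fin d => Icc (-N) N) :=
    isCompact_univ_pi fun _ => isCompact_univ_pi fun _ => isCompact_Icc
  refine IsCompact.of_isClosed_subset hK ?_ ?_
  · exact isClosed_symTraceFree.inter
      (isClosed_le (Real.continuous_sqrt.comp continuous_dot_self) continuous_const)
  · rintro A ⟨-, hA⟩ i - j -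
    exact abs_le.1 ((abs_entry_le_frob A i j).trans hA)

/-- For large `|A|` the quartic term absorbs the quadratic and cubic ones; the remaining symmetric
trace-free matrices form a compact set, on which the continuous positive function attains a positive
minimum. -/
lemma exists_bulk_lower_bound {p : Params} (hp : p.Admissible d) :
    ∃ m > 0, ∀ A : Mat d, SymTraceFree A → m * (1 + frob A) ^ 4 ≤ bulk p A + p.A₀ := by
  have hc := hp.c_pos
  set D : ℝ := (d : ℝ) ^ 3 with hD
  have hD0 : 0 ≤ D := by positivity
  set E : ℝ := |p.a| / 2 + |p.b| / 3 * D with hE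
  have hE0 : 0 ≤ E := by positivity
  -- For `n = |A| ≥ 1` the lower-order terms are at most `E n³`, and `n ≥ N` makes this at most `c
  -- n⁴ / 8`, half of the quartic term. With `1 + n ≤ 2 n` the other half gives the constant `c /
  -- 128`.
  set N : ℝ := 1 + 8 * E / p.c with hN
  have hN1 : 1 ≤ N := by rw [hN]; have : 0 ≤ 8 * E / p.c := by positivity
                         linarith
  have hlarge : ∀ A : Mat d, SymTraceFree A → N ≤ frob A →
      p.c / 128 * (1 + frob A) ^ 4 ≤ bulk p A + p.A₀ := by
    intro A hA hAN
    have h2 := trace_sq_of_isSymm hA.1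
    have h3 := abs_trace_cube_le A
    set n := frob A
    have hn1 : 1 ≤ n := hN1.trans hAN
    have hEc : 8 * E ≤ p.c * n := by
      have : 8 * E / p.c ≤ n := by linarith
      rw [div_le_iff₀ hc] at this; linarith
    have ha : -(|p.a| / 2 * n ^ 3) ≤ p.a / 2 * n ^ 2 := by
      have h23 : n ^ 2 ≤ n ^ 3 := pow_le_pow_right₀ hn1 (by norm_num)
      have := neg_abs_le p.a
      nlinarith [abs_nonneg p.a, sq_nonneg n]
    have hb : -(|p.b| / 3 * (D * n ^ 3)) ≤ - (p.b / 3 * (A ^ 3).trace) := by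
      have : |p.b * (A ^ 3).trace| ≤ |p.b| * (D * n ^ 3) := by
        rw [abs_mul]; gcongr
      have := (abs_le.1 this).2
      linarith
    have hn3 : 0 ≤ n ^ 3 := by positivity
    have hmul : 8 * E * n ^ 3 ≤ p.c * n * n ^ 3 := mul_le_mul_of_nonneg_right hEc hn3
    have h1n : (1 + n) ^ 4 ≤ (2 * n) ^ 4 := by gcongr; linarith
    have hEn : E * n ^ 3 = |p.a| / 2 * n ^ 3 + |p.b| / 3 * (D * n ^ 3) := by rw [hE]; ring
    have hA0 := hp.A₀_pos
    have : bulk p A = p.a / 2 * n ^ 2 - p.b / 3 * (A ^ 3).trace + p.c / 4 * n ^ 4 := by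
      rw [bulk, h2]; ring
    rw [this]
    nlinarith [mul_le_mul_of_nonneg_left h1n hc.le]
  have hne : {A : Mat d | SymTraceFree A ∧ frob A ≤ N}.Nonempty :=
    ⟨0, ⟨Matrix.isSymm_zero, by simp⟩, by simp [frob, dot]; linarith⟩
  obtain ⟨A₁, hA₁, hmin⟩ := (isCompact_symTraceFree_frob_le N).exists_isMinOn hne
    ((continuous_bulk p).add continuous_const :
      Continuous fun A : Mat d => bulk p A + p.A₀).continuousOn
  set μ := bulk p A₁ + p.A₀ with hμ
  have hμ0 : 0 < μ := hp.r_pos A₁ hA₁.1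
  refine ⟨min (p.c / 128) (μ / (1 + N) ^ 4), by positivity, fun A hA => ?_⟩
  have hn0 := frob_nonneg A
  rcases le_total N (frob A) with h | h
  · refine le_trans ?_ (hlarge A hA h)
    gcongr; exact min_le_left _ _
  · have h1 : μ ≤ bulk p A + p.A₀ := hmin ⟨hA, h⟩
    refine le_trans ?_ h1
    calc min (p.c / 128) (μ / (1 + N) ^ 4) * (1 + frob A) ^ 4
        ≤ μ / (1 + N) ^ 4 * (1 + N) ^ 4 := by
          gcongr; exact min_le_right _ _
      _ = μ := by field_simp

lemma exists_S_bound (p : Params) :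
    ∃ K ≥ 0, ∀ A : Mat d, A.IsSymm → ∀ i j, |S p A i j| ≤ K * (1 + frob A) ^ 3 := by
  refine ⟨|p.a| + |p.b| * (d + 1) + |p.c|, by positivity, fun A hA i j => ?_⟩
  have h2 := trace_sq_of_isSymm hA
  have he := abs_entry_le_frob A i j
  have hsq : |(A ^ 2) i j| ≤ d * frob A ^ 2 := by
    rw [sq, Matrix.mul_apply]
    refine (Finset.abs_sum_le_sum_abs _ _).trans ?_
    have : ∀ k, |A i k * A k j| ≤ frob A ^ 2 := fun k => by
      rw [abs_mul, sq]
      have := frob_nonneg A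
      gcongr <;> exact abs_entry_le_frob A _ _
    refine (Finset.sum_le_sum fun k _ => this k).trans (by simp)
  have hid : |1 / (d : ℝ) * frob A ^ 2 * (1 : Mat d) i j| ≤ frob A ^ 2 := by
    -- The index `i` witnesses that the dimension is positive.
    have hd : (1 : ℝ) ≤ d := by
      have := i.pos
      exact_mod_cast this
    rw [Matrix.one_apply]
    split_ifs
    · rw [mul_one, abs_of_nonneg (by positivity)]
      have : 1 / (d : ℝ) ≤ 1 := by rw [div_le_one (by linarith)]; exact hd
      nlinarith [sq_nonneg (frob A)]
    · simp; positivity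
  set n := frob A with hn
  have hn0 : 0 ≤ n := frob_nonneg A
  have hS : S p A i j = p.a * A i j - p.b * ((A ^ 2) i j - 1 / (d : ℝ) * n ^ 2 * (1 : Mat d) i j)
      + p.c * n ^ 2 * A i j := by
    simp [S, h2]
  rw [hS]
  have t1 : |p.a * A i j| ≤ |p.a| * (1 + n) ^ 3 := by
    rw [abs_mul]; gcongr; nlinarith [pow_nonneg hn0 3, pow_nonneg hn0 2]
  have t2 : |p.b * ((A ^ 2) i j - 1 / (d : ℝ) * n ^ 2 * (1 : Mat d) i j)|
      ≤ |p.b| * ((d + 1) * (1 + n) ^ 3) := by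
    rw [abs_mul]; gcongr
    refine (abs_sub _ _).trans ?_
    have : n ^ 2 ≤ (1 + n) ^ 3 := by nlinarith [pow_nonneg hn0 3, pow_nonneg hn0 2]
    have hd : (0 : ℝ) ≤ d := by positivity
    nlinarith
  have t3 : |p.c * n ^ 2 * A i j| ≤ |p.c| * (1 + n) ^ 3 := by
    rw [mul_assoc, abs_mul, abs_mul, abs_of_nonneg (by positivity : 0 ≤ n ^ 2)]; gcongr
    calc n ^ 2 * |A i j| ≤ n ^ 2 * n := by gcongr
      _ = n ^ 3 := by ring
      _ ≤ (1 + n) ^ 3 := by gcongr; linarith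
  refine (abs_add_le _ _).trans ((add_le_add ((abs_sub _ _).trans (add_le_add t1 t2)) t3).trans ?_)
  apply le_of_eq; ring

lemma rFun_pos {p : Params} (hp : p.Admissible d) {A : Mat d} (hA : SymTraceFree A) :
    0 < rFun p A := Real.sqrt_pos.2 (mul_pos two_pos (hp.r_pos A hA))

lemma rFun_sq {p : Params} (hp : p.Admissible d) {A : Mat d} (hA : SymTraceFree A) :
    rFun p A ^ 2 = 2 * (bulk p A + p.A₀) :=
  Real.sq_sqrt (mul_pos two_pos (hp.r_pos A hA)).le

lemma rFun_smul_P {p : Params} (hp : p.Admissible d) {A : Mat d} (hA : SymTraceFree A) :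
    rFun p A • P p A = S p A := by
  rw [P, smul_smul, mul_inv_cancel₀ (rFun_pos hp hA).ne', one_smul]

/-- A numerator of cubic growth is divided by `r`, which grows at least quadratically. This is what
puts `P(Q)` in `L²` as soon as `Q` is. -/
lemma exists_P_bound {p : Params} (hp : p.Admissible d) :
    ∃ C ≥ 0, ∀ A : Mat d, SymTraceFree A → ∀ i j, |P p A i j| ≤ C * (1 + frob A) := by
  obtain ⟨m, hm, hlow⟩ := exists_bulk_lower_bound hp
  obtain ⟨K, hK, hS⟩ := exists_S_bound (d := d) p
  refine ⟨K / Real.sqrt m, by positivity, fun A hA i j => ?_⟩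
  have hn := frob_nonneg A
  have hr : Real.sqrt m * (1 + frob A) ^ 2 ≤ rFun p A := by
    have h1 : Real.sqrt m * (1 + frob A) ^ 2 = Real.sqrt (m * (1 + frob A) ^ 4) := by
      rw [Real.sqrt_mul hm.le, show (1 + frob A) ^ 4 = ((1 + frob A) ^ 2) ^ 2 by ring,
        Real.sqrt_sq (by positivity)]
    rw [h1]
    refine Real.sqrt_le_sqrt ?_
    have := hlow A hA
    have := hp.r_pos A hA
    linarith
  have hsm : 0 < Real.sqrt m := Real.sqrt_pos.2 hm
  have hP : |P p A i j| = |S p A i j| / rFun p A := by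
    simp only [P, Matrix.smul_apply, smul_eq_mul, abs_mul, abs_inv]
    rw [abs_of_pos (rFun_pos hp hA)]; ring
  rw [hP, div_le_iff₀ (rFun_pos hp hA)]
  calc |S p A i j| ≤ K * (1 + frob A) ^ 3 := hS A hA.1 i j
    _ = K / Real.sqrt m * (1 + frob A) * (Real.sqrt m * (1 + frob A) ^ 2) := by
        field_simp
    _ ≤ _ := by gcongr

/-- `r` grows at most quadratically. -/
lemma exists_rFun_bound (p : Params) :
    ∃ C ≥ 0, ∀ A : Mat d, A.IsSymm → rFun p A ≤ C * (1 + frob A ^ 2) := by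
  refine ⟨1 + 2 * (|p.a| + |p.b| * (d : ℝ) ^ 3 + |p.c| + |p.A₀|), by positivity, fun A hA => ?_⟩
  have h2 := trace_sq_of_isSymm hA
  have h3 := abs_trace_cube_le A
  set n := frob A
  have hn : 0 ≤ n := frob_nonneg A
  set D : ℝ := (d : ℝ) ^ 3 with hD
  have hD0 : 0 ≤ D := by positivity
  have hb : bulk p A = p.a / 2 * n ^ 2 - p.b / 3 * (A ^ 3).trace + p.c / 4 * n ^ 4 := by
    rw [bulk, h2]; ring
  have e2 : n ^ 2 ≤ (1 + n ^ 2) ^ 2 := by nlinarith [pow_nonneg hn 2, pow_nonneg hn 4]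
  have e3 : n ^ 3 ≤ (1 + n ^ 2) ^ 2 := by
    nlinarith [pow_nonneg hn 2, pow_nonneg hn 4, sq_nonneg (n ^ 2 - n)]
  have e4 : n ^ 4 ≤ (1 + n ^ 2) ^ 2 := by nlinarith [pow_nonneg hn 2, pow_nonneg hn 4]
  have e0 : 1 ≤ (1 + n ^ 2) ^ 2 := by nlinarith [pow_nonneg hn 2, pow_nonneg hn 4]
  set z := (1 + n ^ 2) ^ 2 with hz
  have t1 : p.a * n ^ 2 ≤ |p.a| * z :=
    (mul_le_mul_of_nonneg_right (le_abs_self _) (by positivity)).trans (by gcongr)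
  have t2 : -(p.b * (A ^ 3).trace) ≤ |p.b| * D * z := by
    refine (neg_le_abs _).trans ?_
    rw [abs_mul, mul_assoc]; gcongr
    exact h3.trans (by gcongr)
  have t3 : p.c * n ^ 4 ≤ |p.c| * z :=
    (mul_le_mul_of_nonneg_right (le_abs_self _) (by positivity)).trans (by gcongr)
  have t4 : p.A₀ ≤ |p.A₀| * z := (le_abs_self _).trans (by nlinarith [abs_nonneg p.A₀])
  have q1 : 0 ≤ |p.a| * z := by positivity
  have q2 : 0 ≤ |p.b| * D * z := by positivity
  have q3 : 0 ≤ |p.c| * z := by positivity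
  have q4 : 0 ≤ |p.A₀| * z := by positivity
  set B := |p.a| + |p.b| * D + |p.c| + |p.A₀| with hB
  have hB0 : 0 ≤ B := by positivity
  have key : 2 * (bulk p A + p.A₀) ≤ 2 * B * z := by rw [hb, hB]; nlinarith
  refine Real.sqrt_le_iff.2 ⟨by positivity, key.trans ?_⟩
  rw [mul_pow]
  gcongr
  nlinarith

/-! ### The chain rule for `r` along absolutely continuous curves -/

/-- The Lipschitz bound is asked only on the values taken by `f`, so that it applies to the square
root on a range bounded away from zero. -/
lemma _root_.AbsolutelyContinuousOnInterval.lipschitz_comp {f g : ℝ → ℝ} {a b K : ℝ}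
    (hf : AbsolutelyContinuousOnInterval f a b)
    (hg : ∀ s ∈ uIcc a b, ∀ t ∈ uIcc a b, |g (f s) - g (f t)| ≤ K * |f s - f t|) :
    AbsolutelyContinuousOnInterval (fun t => g (f t)) a b := by
  unfold AbsolutelyContinuousOnInterval at hf ⊢
  refine squeeze_zero' ?_ ?_ (by simpa using hf.const_mul K)
  · exact Eventually.of_forall fun _ => Finset.sum_nonneg fun _ _ => dist_nonneg
  rw [eventually_inf_principal]
  filter_upwards with (n, I) hnI
  simp only [Finset.mul_sum]
  refine Finset.sum_le_sum fun i hi => ?_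
  simp only [AbsolutelyContinuousOnInterval.disjWithin, mem_ofPred_eq] at hnI
  exact hg _ (hnI.left i hi).left _ (hnI.left i hi).right

lemma _root_.AbsolutelyContinuousOnInterval.const (c a b : ℝ) :
    AbsolutelyContinuousOnInterval (fun _ => c) a b :=
  (LipschitzWith.const c).lipschitzOnWith.absolutelyContinuousOnInterval

lemma _root_.AbsolutelyContinuousOnInterval.finset_sum {ι : Type*} (s : Finset ι) {f : ι → ℝ → ℝ}
    {a b : ℝ} (hf : ∀ i ∈ s, AbsolutelyContinuousOnInterval (f i) a b) :
    AbsolutelyContinuousOnInterval (fun t => ∑ i ∈ s, f i t) a b := by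
  classical
  induction s using Finset.induction_on with
  | empty => simpa using AbsolutelyContinuousOnInterval.const 0 a b
  | insert i s hi ih =>
    simp only [Finset.sum_insert hi]
    exact (hf i (Finset.mem_insert_self _ _)).fun_add
      (ih fun j hj => hf j (Finset.mem_insert_of_mem hj))

lemma absolutelyContinuousOnInterval_bulk (p : Params) {v : ℝ → Mat d} {a b : ℝ}
    (hv : ∀ i j, AbsolutelyContinuousOnInterval (fun t => v t i j) a b) :
    AbsolutelyContinuousOnInterval (fun t => bulk p (v t)) a b := by
  have h2 : AbsolutelyContinuousOnInterval (fun t => ((v t) ^ 2).trace) a b := by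
    simp_rw [trace_sq_eq_sum]
    exact .finset_sum _ fun i _ => .finset_sum _ fun j _ => (hv i j).fun_mul (hv j i)
  have h3 : AbsolutelyContinuousOnInterval (fun t => ((v t) ^ 3).trace) a b := by
    simp_rw [trace_cube_eq_sum]
    exact .finset_sum _ fun i _ => .finset_sum _ fun j _ => .finset_sum _ fun k _ =>
      ((hv i j).fun_mul (hv j k)).fun_mul (hv k i)
  unfold bulk
  simp_rw [sq ((_ ^ 2 : Mat d).trace)]
  exact ((h2.const_mul _).fun_sub (h3.const_mul _)).fun_add ((h2.fun_mul h2).const_mul _)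

/-- The constraints are linear, hence inherited by derivatives. Nothing is assumed about the values
of the weak time derivative, so its constraints have to be recovered in this way. -/
lemma symTraceFree_of_hasDerivAt {v : ℝ → Mat d} {w : Mat d} {t : ℝ}
    (hv : ∀ᶠ s in 𝓝 t, SymTraceFree (v s))
    (hd : ∀ i j, HasDerivAt (fun s => v s i j) (w i j) t) : SymTraceFree w := by
  constructor
  · ext i j
    refine (hd j i).unique ((hd i j).congr_of_eventuallyEq ?_)
    filter_upwards [hv] with s hs using hs.1.apply i j
  · have h1 : HasDerivAt (fun s => ∑ i, v s i i) (∑ i, w i i) t :=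
      HasDerivAt.fun_sum fun i _ => hd i i
    refine h1.unique ((hasDerivAt_const t (0 : ℝ)).congr_of_eventuallyEq ?_)
    filter_upwards [hv] with s hs using hs.2

/-- The Euclidean gradient at a symmetric `Q` is `a Q - b Q² + c tr(Q²) Q`. The correction by a
multiple of the identity that makes up `S` is invisible to a trace-free direction `w`. -/
lemma hasDerivAt_bulk (p : Params) {v : ℝ → Mat d} {w : Mat d} {t : ℝ}
    (hv : (v t).IsSymm) (hw : SymTraceFree w)
    (hd : ∀ i j, HasDerivAt (fun s => v s i j) (w i j) t) :
    HasDerivAt (fun s => bulk p (v s)) (dot (S p (v t)) w) t := by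
  set q := v t with hq
  have h2 : HasDerivAt (fun s => ((v s) ^ 2).trace) (2 * dot q w) t := by
    simp_rw [trace_sq_eq_sum]
    have h := HasDerivAt.fun_sum (u := Finset.univ) fun i _ =>
      HasDerivAt.fun_sum (u := Finset.univ) fun j _ => (hd i j).fun_mul (hd j i)
    refine h.congr_deriv ?_
    simp only [dot, Finset.mul_sum]
    refine Finset.sum_congr rfl fun i _ => Finset.sum_congr rfl fun j _ => ?_
    rw [← hq, hv.apply i j, hw.1.apply i j]; ring
  have h3 : HasDerivAt (fun s => ((v s) ^ 3).trace) (3 * dot (q ^ 2) w) t := by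
    simp_rw [trace_cube_eq_sum]
    have h := HasDerivAt.fun_sum (u := Finset.univ) fun i _ =>
      HasDerivAt.fun_sum (u := Finset.univ) fun j _ =>
      HasDerivAt.fun_sum (u := Finset.univ) fun k _ => ((hd i j).fun_mul (hd j k)).fun_mul (hd k i)
    refine h.congr_deriv ?_
    rw [← hq]
    have hc : dot (q ^ 2) w = ∑ i, ∑ j, ∑ k, w i j * q j k * q k i := by
      simp only [dot, sq q, Matrix.mul_apply, Finset.sum_mul]
      refine Finset.sum_congr rfl fun i _ => Finset.sum_congr rfl fun j _ =>
        Finset.sum_congr rfl fun k _ => ?_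
      rw [hv.apply j k, hv.apply i k]; ring
    -- Cyclic invariance of the trace: the three terms of the product rule coincide after
    -- relabelling the indices.
    have hr1 : ∑ i, ∑ j, ∑ k, q i j * w j k * q k i = ∑ i, ∑ j, ∑ k, w i j * q j k * q k i := by
      calc _ = ∑ j, ∑ i, ∑ k, q i j * w j k * q k i := Finset.sum_comm
        _ = ∑ j, ∑ k, ∑ i, q i j * w j k * q k i :=
          Finset.sum_congr rfl fun j _ => Finset.sum_comm
        _ = _ := Finset.sum_congr rfl fun _ _ => Finset.sum_congr rfl fun _ _ =>
          Finset.sum_congr rfl fun _ _ => by ring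
    have hr2 : ∑ i, ∑ j, ∑ k, q i j * q j k * w k i = ∑ i, ∑ j, ∑ k, w i j * q j k * q k i := by
      calc _ = ∑ i, ∑ k, ∑ j, q i j * q j k * w k i :=
          Finset.sum_congr rfl fun _ _ => Finset.sum_comm
        _ = ∑ k, ∑ i, ∑ j, q i j * q j k * w k i := Finset.sum_comm
        _ = _ := Finset.sum_congr rfl fun _ _ => Finset.sum_congr rfl fun _ _ =>
          Finset.sum_congr rfl fun _ _ => by ring
    have : ∀ i j k, (w i j * q j k + q i j * w j k) * q k i + q i j * q j k * w k i
        = w i j * q j k * q k i + q i j * w j k * q k i + q i j * q j k * w k i :=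
      fun _ _ _ => by ring
    simp only [this, Finset.sum_add_distrib, hr1, hr2, hc]
    ring
  have h := ((h2.const_mul (p.a / 2)).sub (h3.const_mul (p.b / 3))).add
    ((h2.fun_pow 2).const_mul (p.c / 4))
  refine (h.congr_of_eventuallyEq (f := fun s => bulk p (v s)) ?_).congr_deriv ?_
  · exact Eventually.of_forall fun s => rfl
  have htr : dot (1 : Mat d) w = 0 := by
    rw [← hw.2]; simp [dot, Matrix.trace, Matrix.one_apply]
  have hS : dot (S p q) w = p.a * dot q w
      - p.b * (dot (q ^ 2) w - 1 / (d : ℝ) * (q ^ 2).trace * dot (1 : Mat d) w)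
      + p.c * (q ^ 2).trace * dot q w := by
    simp only [dot, S, Matrix.add_apply, Matrix.sub_apply, Matrix.smul_apply, smul_eq_mul,
      Finset.mul_sum, ← Finset.sum_add_distrib, ← Finset.sum_sub_distrib]
    refine Finset.sum_congr rfl fun i _ => Finset.sum_congr rfl fun j _ => ?_
    ring
  rw [hS, htr, ← hq]; push_cast; ring

/-- If `v` is absolutely continuous with derivative `w` and takes symmetric trace-free values,
then `r(v)' = P(v) : w`, in integrated form. -/
lemma rFun_eq_integral {p : Params} (hp : p.Admissible d) {v w : ℝ → Mat d} {T : ℝ} (hT : 0 ≤ T)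
    (hw : ∀ i j, IntervalIntegrable (fun s => w s i j) volume 0 T)
    (hv : ∀ t ∈ Icc 0 T, ∀ i j, v t i j = v 0 i j + ∫ s in (0 : ℝ)..t, w s i j)
    (hst : ∀ t ∈ Icc 0 T, SymTraceFree (v t)) :
    ∀ t ∈ Icc 0 T, rFun p (v t) = rFun p (v 0) + ∫ s in (0 : ℝ)..t, dot (P p (v s)) (w s) := by
  intro t ht
  have hsub : uIcc 0 t ⊆ Icc 0 T := by rw [uIcc_of_le ht.1]; exact Icc_subset_Icc_right ht.2
  have hwt : ∀ i j, IntervalIntegrable (fun s => w s i j) volume 0 t := fun i j =>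
    (hw i j).mono_set (by rw [uIcc_of_le hT]; exact hsub)
  have hac0 : ∀ i j, AbsolutelyContinuousOnInterval
      (fun s => v 0 i j + ∫ y in (0 : ℝ)..s, w y i j) 0 t := fun i j =>
    (AbsolutelyContinuousOnInterval.const _ _ _).fun_add
      ((hwt i j).absolutelyContinuousOnInterval_intervalIntegral left_mem_uIcc)
  -- The formula for `v` is available only on `[0,T]`, so absolute continuity is transferred through
  -- its definition, which samples points of the interval alone.
  have hac : ∀ i j, AbsolutelyContinuousOnInterval (fun s => v s i j) 0 t := fun i j => by
    have := hac0 i j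
    rw [absolutelyContinuousOnInterval_iff] at this ⊢
    intro ε hε
    obtain ⟨δ, hδ, H⟩ := this ε hε
    refine ⟨δ, hδ, fun E hE hlt => ?_⟩
    have := H E hE hlt
    refine lt_of_eq_of_lt (Finset.sum_congr rfl fun k hk => ?_) this
    simp only [AbsolutelyContinuousOnInterval.disjWithin, mem_ofPred_eq] at hE
    rw [hv _ (hsub (hE.1 k hk).1), hv _ (hsub (hE.1 k hk).2)]
  obtain ⟨m, hm, hlow⟩ := exists_bulk_lower_bound hp
  have hlow' : ∀ s ∈ uIcc 0 t, m ≤ 2 * (bulk p (v s) + p.A₀) := fun s hs => by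
    have h1 := hlow _ (hst s (hsub hs))
    have h2 : (1 : ℝ) ≤ (1 + frob (v s)) ^ 4 := one_le_pow₀ (by linarith [frob_nonneg (v s)])
    nlinarith
  have hacF : AbsolutelyContinuousOnInterval (fun s => 2 * (bulk p (v s) + p.A₀)) 0 t :=
    ((absolutelyContinuousOnInterval_bulk p hac).fun_add
      (AbsolutelyContinuousOnInterval.const _ _ _)).const_mul 2
  have hacr : AbsolutelyContinuousOnInterval (fun s => rFun p (v s)) 0 t := by
    -- On `[m, ∞)` one has `|√x - √y| = |x - y| / (√x + √y) ≤ |x - y| / √m`.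
    refine hacF.lipschitz_comp (g := Real.sqrt) (K := (Real.sqrt m)⁻¹) fun s hs s' hs' => ?_
    have hx := hlow' s hs
    have hy := hlow' s' hs'
    set x := 2 * (bulk p (v s) + p.A₀)
    set y := 2 * (bulk p (v s') + p.A₀)
    have hsm : 0 < Real.sqrt m := Real.sqrt_pos.2 hm
    have hxs : Real.sqrt m ≤ Real.sqrt x := Real.sqrt_le_sqrt hx
    have hys : 0 ≤ Real.sqrt y := Real.sqrt_nonneg y
    have hxy : x - y = (Real.sqrt x - Real.sqrt y) * (Real.sqrt x + Real.sqrt y) := by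
      have := Real.sq_sqrt (hm.le.trans hx)
      have := Real.sq_sqrt (hm.le.trans hy)
      nlinarith
    rw [inv_mul_eq_div, le_div_iff₀ hsm, hxy, abs_mul]
    gcongr
    exact hxs.trans ((le_add_of_nonneg_right hys).trans (le_abs_self _))
  have hder : ∀ᵐ s, s ∈ uIoc 0 t → deriv (fun s => rFun p (v s)) s = dot (P p (v s)) (w s) := by
    have h1 : ∀ᵐ s, ∀ i j, s ∈ uIcc 0 t →
        HasDerivAt (fun s => ∫ y in (0 : ℝ)..s, w y i j) (w s i j) s := by
      rw [ae_all_iff]; intro i; rw [ae_all_iff]; intro j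
      filter_upwards [(hwt i j).ae_hasDerivAt_integral] with s hs hs'
      exact hs hs' 0 left_mem_uIcc
    -- Dropping the right endpoint leaves interior points, where the formula for `v` holds on a full
    -- neighbourhood and can be differentiated.
    have h2 : ∀ᵐ s : ℝ, s ≠ t := by simp [ae_iff]
    filter_upwards [h1, h2] with s hs hst' hmem
    have hmem' : s ∈ Ioo 0 t := by
      rw [uIoc_of_le ht.1] at hmem
      exact ⟨hmem.1, lt_of_le_of_ne hmem.2 hst'⟩
    have hnh : ∀ᶠ y in 𝓝 s, y ∈ Icc 0 T := by
      filter_upwards [Ioo_mem_nhds hmem'.1 hmem'.2] with y hy using ⟨hy.1.le, hy.2.le.trans ht.2⟩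
    have hd : ∀ i j, HasDerivAt (fun s => v s i j) (w s i j) s := fun i j => by
      refine ((hs i j (uIoc_subset_uIcc hmem)).const_add (v 0 i j)).congr_of_eventuallyEq ?_
      filter_upwards [hnh] with y hy using hv y hy i j
    have hvs : SymTraceFree (v s) := hst s hnh.self_of_nhds
    have hws : SymTraceFree (w s) := symTraceFree_of_hasDerivAt
      (hnh.mono fun y hy => hst y hy) hd
    have hb := ((hasDerivAt_bulk p hvs.1 hws hd).add_const p.A₀).const_mul 2
    have hpos : 2 * (bulk p (v s) + p.A₀) ≠ 0 := (mul_pos two_pos (hp.r_pos _ hvs)).ne'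
    have := (hb.sqrt hpos).deriv
    refine this.trans ?_
    have hr := (rFun_pos hp hvs).ne'
    change 2 * dot (S p (v s)) (w s) / (2 * rFun p (v s)) = _
    have : dot (P p (v s)) (w s) = (rFun p (v s))⁻¹ * dot (S p (v s)) (w s) := by
      simp only [dot, P, Matrix.smul_apply, smul_eq_mul, Finset.mul_sum, mul_assoc]
    rw [this]; field_simp
  have := hacr.integral_deriv_eq_sub
  rw [intervalIntegral.integral_congr_ae hder] at this
  linarith

/-! ### Primitives in time and the fundamental lemma of the calculus of variations -/

/-- Rectangles form a π-system generating the product σ-algebra, and the sets over which an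
integrable function with zero total integral integrates to zero form a Dynkin system. -/
lemma ae_eq_zero_of_setIntegral_prod_eq_zero {α β : Type*} [MeasurableSpace α]
    [MeasurableSpace β] {μ : Measure α} {ν : Measure β} {f : α × β → ℝ}
    (hf : Integrable f (μ.prod ν))
    (h : ∀ s t, MeasurableSet s → MeasurableSet t → ∫ z in s ×ˢ t, f z ∂(μ.prod ν) = 0) :
    f =ᵐ[μ.prod ν] 0 := by
  have huniv : ∫ z, f z ∂(μ.prod ν) = 0 := by
    have := h univ univ MeasurableSet.univ MeasurableSet.univ
    rwa [univ_prod_univ, setIntegral_univ] at this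
  have hall : ∀ s, MeasurableSet s → ∫ z in s, f z ∂(μ.prod ν) = 0 := fun s hs => by
    induction s, hs using MeasurableSpace.induction_on_inter generateFrom_prod.symm
      isPiSystem_prod with
    | empty => simp
    | basic t ht =>
      obtain ⟨a, ha, b, hb, rfl⟩ := ht
      exact h a b ha hb
    | compl t ht ih =>
      have := integral_add_compl ht hf
      rw [ih, huniv] at this
      linarith
    | iUnion t hd ht ih =>
      rw [integral_iUnion ht hd hf.integrableOn]
      simp [ih]
  exact hf.ae_eq_zero_of_forall_setIntegral_eq_zero fun s hs _ => hall s hs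

/-- The one-dimensional fundamental lemma, with boundary terms. -/
lemma eq_primitive_of_forall_integral_mul_deriv {T : ℝ} (hT : 0 < T) {U f : ℝ → ℝ} {α β : ℝ}
    (hU : IntegrableOn U (Ioo 0 T)) (hf : IntegrableOn f (Ioo 0 T))
    (h : ∀ η : ℝ → ℝ, ContDiff ℝ ∞ η → HasCompactSupport η →
      (∫ t in Ioo 0 T, U t * deriv η t) - η T * α + η 0 * β = -∫ t in Ioo 0 T, f t * η t) :
    (∀ᵐ t ∂(volume.restrict (Ioo 0 T)), U t = β + ∫ s in (0 : ℝ)..t, f s) ∧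
      α = β + ∫ s in (0 : ℝ)..T, f s := by
  set W : ℝ → ℝ := fun t => β + ∫ s in (0 : ℝ)..t, f s with hW
  have hfi : IntervalIntegrable f volume 0 T := by
    rw [intervalIntegrable_iff_integrableOn_Ioo_of_le hT.le]; exact hf
  have hWac : AbsolutelyContinuousOnInterval W 0 T :=
    (AbsolutelyContinuousOnInterval.const _ _ _).fun_add
      (hfi.absolutelyContinuousOnInterval_intervalIntegral left_mem_uIcc)
  have hWi : IntegrableOn W (Ioo 0 T) :=
    (hWac.continuousOn.integrableOn_compact isCompact_uIcc).mono_set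
      (by rw [uIcc_of_le hT.le]; exact Ioo_subset_Icc_self)
  have hW0 : W 0 = β := by simp [hW]
  have hWd : ∀ᵐ t, t ∈ uIoc 0 T → deriv W t = f t := by
    filter_upwards [hfi.ae_hasDerivAt_integral] with t ht hmem
    exact ((ht (uIoc_subset_uIcc hmem) 0 left_mem_uIcc).const_add β).deriv
  have toI : ∀ k : ℝ → ℝ, ∫ t in Ioo 0 T, k t = ∫ t in (0 : ℝ)..T, k t := fun k => by
    rw [intervalIntegral.integral_of_le hT.le, integral_Ioc_eq_integral_Ioo]
  -- Integrating the absolutely continuous `W` by parts cancels the term at time `0`, because `W 0 =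
  -- β`, and leaves only the defect at `T`.
  have key : ∀ η : ℝ → ℝ, ContDiff ℝ ∞ η → HasCompactSupport η →
      ∫ t in Ioo 0 T, (U t - W t) * deriv η t = η T * (α - W T) := by
    intro η hη hηc
    have hηac : AbsolutelyContinuousOnInterval η 0 T :=
      (hη.of_le (by exact_mod_cast le_top)).contDiffOn.absolutelyContinuousOnInterval
    have h1 := hWac.integral_mul_deriv_eq_deriv_mul hηac
    have h2 : ∫ t in (0 : ℝ)..T, deriv W t * η t = ∫ t in (0 : ℝ)..T, f t * η t :=
      intervalIntegral.integral_congr_ae (hWd.mono fun t ht hm => by rw [ht hm])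
    have h3 := h η hη hηc
    have hdc : Continuous (deriv η) := hη.continuous_deriv (by simp)
    obtain ⟨C, hC⟩ := (hηc.deriv).exists_bound_of_continuous hdc
    have bdd : ∀ k : ℝ → ℝ, IntegrableOn k (Ioo 0 T) →
        IntegrableOn (fun t => k t * deriv η t) (Ioo 0 T) := fun k hk =>
      hk.mul_bdd (c := C) hdc.aestronglyMeasurable (Eventually.of_forall hC)
    simp_rw [sub_mul]
    rw [integral_sub (bdd U hU) (bdd W hWi), toI (fun t => W t * deriv η t), h1, h2, ← toI, hW0]
    linarith
  -- A cutoff equal to one near `[0,T]`; it gives compact support to test functions that need not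
  -- vanish at the endpoints.
  let θ : ContDiffBump (0 : ℝ) := ⟨T + 1, T + 2, by linarith, by linarith⟩
  have hθ1 : ∀ t ∈ Icc 0 T, (θ : ℝ → ℝ) =ᶠ[𝓝 t] 1 := fun t ht => by
    refine θ.eventuallyEq_one_of_mem_ball ?_
    rw [Metric.mem_ball, dist_zero_right, Real.norm_eq_abs, abs_of_nonneg ht.1]
    change t < T + 1
    linarith [ht.2]
  have hUW : ∀ᵐ t, t ∈ Ioo 0 T → U t - W t = 0 := by
    refine isOpen_Ioo.ae_eq_zero_of_integral_contDiff_smul_eq_zero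
      ((hU.sub hWi).locallyIntegrableOn) fun ζ hζ hζc hζs => ?_
    -- The primitive is based at `T`, so the boundary term in `key` vanishes; on `(0,T)` the
    -- function `θ Z` has derivative `ζ`.
    set Z : ℝ → ℝ := fun t => ∫ s in T..t, ζ s with hZ
    have hZd : ∀ t, HasDerivAt Z (ζ t) t := fun t =>
      hζ.continuous.integral_hasStrictDerivAt T t |>.hasDerivAt
    have hZs : ContDiff ℝ ∞ Z := by
      rw [contDiff_infty_iff_deriv]
      refine ⟨fun t => (hZd t).differentiableAt, ?_⟩
      rwa [funext fun t => (hZd t).deriv]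
    have := key (fun t => θ t * Z t) (θ.contDiff.mul hZs) θ.hasCompactSupport.mul_right
    have hZT : Z T = 0 := by simp [hZ]
    rw [hZT, mul_zero, zero_mul] at this
    rw [← this, ← setIntegral_eq_integral_of_forall_compl_eq_zero (s := Ioo 0 T)]
    · refine setIntegral_congr_fun measurableSet_Ioo fun t ht => ?_
      have hd : HasDerivAt (fun t => θ t * Z t) (ζ t) t := by
        refine (hZd t).congr_of_eventuallyEq ?_
        filter_upwards [hθ1 t (Ioo_subset_Icc_self ht)] with y hy
        rw [hy, Pi.one_apply, one_mul]
      simp only [hd.deriv, smul_eq_mul]; ring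
    · intro t ht
      have : ζ t = 0 := image_eq_zero_of_notMem_tsupport fun h' => ht (hζs h')
      rw [this, zero_smul]
  refine ⟨?_, ?_⟩
  · rw [ae_restrict_iff' measurableSet_Ioo]
    filter_upwards [hUW] with t ht hm
    exact sub_eq_zero.1 (ht hm)
  -- The cutoff itself has zero derivative on `(0,T)` and value one at `T`, which isolates the final
  -- value.
  · have := key θ θ.contDiff θ.hasCompactSupport
    rw [(hθ1 T ⟨hT.le, le_rfl⟩).self_of_nhds, Pi.one_apply, one_mul,
      setIntegral_congr_fun (g := fun _ => 0) measurableSet_Ioo] at this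
    · simp only [integral_zero] at this
      exact (sub_eq_zero.1 this.symm)
    · intro t ht
      have : HasDerivAt θ 0 t :=
        (hasDerivAt_const t (1 : ℝ)).congr_of_eventuallyEq (hθ1 t (Ioo_subset_Icc_self ht))
      simp [this.deriv]

lemma ae_prod_of_ae_right {X : Type*} [MeasurableSpace X] {μ : Measure X} {T : ℝ}
    {p : ℝ → X → Prop} (h : ∀ᵐ x ∂μ, ∀ t ∈ Icc 0 T, p t x) :
    ∀ᵐ q ∂((volume.restrict (Ioo 0 T)).prod μ), p q.1 q.2 := by
  have h1 : ∀ᵐ q ∂((volume.restrict (Ioo 0 T)).prod μ), q.1 ∈ Ioo 0 T :=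
    Measure.quasiMeasurePreserving_fst.ae (ae_restrict_mem measurableSet_Ioo)
  have h2 : ∀ᵐ q ∂((volume.restrict (Ioo 0 T)).prod μ), ∀ t ∈ Icc 0 T, p t q.2 :=
    Measure.quasiMeasurePreserving_snd.ae h
  filter_upwards [h1, h2] with q hq1 hq2 using hq2 q.1 (Ioo_subset_Icc_self hq1)

/-! ### Measurability and integrability of primitives in time -/

section Primitive

variable {X : Type*} [MeasurableSpace X] {μ : Measure X} [SFinite μ] {T : ℝ} {F : ℝ → X → ℝ}

lemma ae_integrableOn_of_integrable_prod
    (hF : Integrable (fun q : ℝ × X => F q.1 q.2) ((volume.restrict (Ioo 0 T)).prod μ)) :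
    ∀ᵐ x ∂μ, IntegrableOn (fun s => F s x) (Ioo 0 T) := hF.prod_left_ae

lemma abs_primitive_le {f : ℝ → ℝ} (hf : IntegrableOn f (Ioo 0 T)) {t : ℝ} (ht : t ∈ Icc 0 T) :
    |∫ s in (0 : ℝ)..t, f s| ≤ ∫ s in Ioo 0 T, |f s| := by
  rw [intervalIntegral.integral_of_le ht.1]
  refine (abs_integral_le_integral_abs).trans ?_
  rw [integral_Ioc_eq_integral_Ioo]
  refine setIntegral_mono_set hf.abs (Eventually.of_forall fun _ => abs_nonneg _) ?_
  exact (Ioo_subset_Ioo_right ht.2).eventuallyLE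

/-- The exceptional set consists of points `x` and is independent of `t`. This works because the
primitive of a strongly measurable representative is an integral of an indicator jointly measurable
in all variables, and for a.e. `x` the representative agrees with `F` at almost all times. -/
lemma exists_stronglyMeasurable_primitive
    (hF : AEStronglyMeasurable (fun q : ℝ × X => F q.1 q.2) ((volume.restrict (Ioo 0 T)).prod μ)) :
    ∃ G : ℝ × X → ℝ, StronglyMeasurable G ∧
      ∀ᵐ x ∂μ, ∀ t ∈ Icc 0 T, ∫ s in (0 : ℝ)..t, F s x = G (t, x) := by
  obtain ⟨F', hF', hae⟩ := hF
  refine ⟨fun q => ∫ s, (Ioc 0 q.1).indicator (fun s => F' (s, q.2)) s, ?_, ?_⟩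
  · have hm : MeasurableSet {z : (ℝ × X) × ℝ | z.2 ∈ Ioc 0 z.1.1} :=
      (measurableSet_lt measurable_const measurable_snd).inter
        (measurableSet_le measurable_snd measurable_fst.fst)
    have h1 : StronglyMeasurable fun z : (ℝ × X) × ℝ => F' (z.2, z.1.2) :=
      hF'.comp_measurable (measurable_snd.prodMk measurable_fst.snd)
    have h2 := (h1.indicator hm).integral_prod_right' (ν := (volume : Measure ℝ))
    exact h2
  · have h1 : ∀ᵐ x ∂μ, ∀ᵐ s ∂(volume.restrict (Ioo 0 T)), F s x = F' (s, x) := by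
      have := Measure.ae_ae_of_ae_prod (Measure.measurePreserving_swap.quasiMeasurePreserving.ae hae)
      exact this
    filter_upwards [h1] with x hx t ht
    rw [intervalIntegral.integral_of_le ht.1, integral_indicator measurableSet_Ioc,
      integral_Ioc_eq_integral_Ioo, integral_Ioc_eq_integral_Ioo]
    exact integral_congr_ae (ae_restrict_of_ae_restrict_of_subset (Ioo_subset_Ioo_right ht.2) hx)

lemma aestronglyMeasurable_primitive_right
    (hF : AEStronglyMeasurable (fun q : ℝ × X => F q.1 q.2) ((volume.restrict (Ioo 0 T)).prod μ))
    {t : ℝ} (ht : t ∈ Icc 0 T) :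
    AEStronglyMeasurable (fun x => ∫ s in (0 : ℝ)..t, F s x) μ := by
  obtain ⟨G, hG, h⟩ := exists_stronglyMeasurable_primitive hF
  refine (hG.comp_measurable measurable_prodMk_left).aestronglyMeasurable.congr
    (f := fun x => G (t, x)) ?_
  filter_upwards [h] with x hx using (hx t ht).symm

lemma aestronglyMeasurable_primitive
    (hF : AEStronglyMeasurable (fun q : ℝ × X => F q.1 q.2)
      ((volume.restrict (Ioo 0 T)).prod μ)) :
    AEStronglyMeasurable (fun q : ℝ × X => ∫ s in (0 : ℝ)..q.1, F s q.2)
      ((volume.restrict (Ioo 0 T)).prod μ) := by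
  obtain ⟨G, hG, h⟩ := exists_stronglyMeasurable_primitive hF
  refine hG.aestronglyMeasurable.congr ?_
  filter_upwards [ae_prod_of_ae_right h] with q hq using hq.symm

lemma integrable_primitive_right
    (hF : Integrable (fun q : ℝ × X => F q.1 q.2) ((volume.restrict (Ioo 0 T)).prod μ))
    {t : ℝ} (ht : t ∈ Icc 0 T) : Integrable (fun x => ∫ s in (0 : ℝ)..t, F s x) μ := by
  have hN : Integrable (fun x => ∫ s in Ioo 0 T, |F s x|) μ := hF.abs.integral_prod_right
  refine hN.mono' (aestronglyMeasurable_primitive_right hF.1 ht) ?_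
  filter_upwards [ae_integrableOn_of_integrable_prod hF] with x hx
  exact abs_primitive_le hx ht

/-- All times share the majorant `x ↦ ∫ |F(s,x)| ds`, which is integrable by Fubini. -/
lemma integrable_primitive
    (hF : Integrable (fun q : ℝ × X => F q.1 q.2) ((volume.restrict (Ioo 0 T)).prod μ)) :
    Integrable (fun q : ℝ × X => ∫ s in (0 : ℝ)..q.1, F s q.2)
      ((volume.restrict (Ioo 0 T)).prod μ) := by
  have hN : Integrable (fun x => ∫ s in Ioo 0 T, |F s x|) μ := hF.abs.integral_prod_right
  refine (hN.comp_snd (volume.restrict (Ioo 0 T))).mono' (aestronglyMeasurable_primitive hF.1) ?_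
  refine ae_prod_of_ae_right
    (p := fun t x => ‖∫ s in (0 : ℝ)..t, F s x‖ ≤ ∫ s in Ioo 0 T, |F s x|) ?_
  filter_upwards [ae_integrableOn_of_integrable_prod hF] with x hx t ht
  exact abs_primitive_le hx ht

end Primitive

lemma volume_restrict_prod (T : ℝ) (Ω : Set (Space d)) :
    (volume : Measure (ℝ × Space d)).restrict (Ioo 0 T ×ˢ Ω)
      = (volume.restrict (Ioo 0 T)).prod (volume.restrict Ω) := by
  rw [Measure.volume_eq_prod, Measure.prod_restrict]

lemma IsTest.exists_bound {Ω : Set (Space d)} {χ : Space d → ℝ} (hχ : IsTest Ω χ) :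
    ∃ C, ∀ x, ‖χ x‖ ≤ C := hχ.2.1.exists_bound_of_continuous hχ.1.continuous

lemma ae_eq_of_forall_integral_test_eq {Ω : Set (Space d)} (hΩ : IsOpen Ω) {u v : Space d → ℝ}
    (hu : LocallyIntegrableOn u Ω) (hv : LocallyIntegrableOn v Ω)
    (h : ∀ χ, IsTest Ω χ → ∫ x in Ω, u x * χ x = ∫ x in Ω, v x * χ x) :
    ∀ᵐ x ∂(volume.restrict Ω), u x = v x := by
  have hint : ∀ w : Space d → ℝ, LocallyIntegrableOn w Ω → ∀ χ, IsTest Ω χ →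
      IntegrableOn (fun x => w x * χ x) Ω := fun w hw χ hχ => by
    have h1 : IntegrableOn w (tsupport χ) :=
      hw.integrableOn_compact_subset hχ.2.2 hχ.2.1
    obtain ⟨C, hC⟩ := hχ.exists_bound
    have h2 : IntegrableOn (fun x => w x * χ x) (tsupport χ) :=
      h1.mul_bdd (c := C) hχ.1.continuous.aestronglyMeasurable (Eventually.of_forall hC)
    refine (h2.integrable_of_forall_notMem_eq_zero fun x hx => ?_).integrableOn
    rw [image_eq_zero_of_notMem_tsupport hx, mul_zero]
  rw [ae_restrict_iff' hΩ.measurableSet]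
  have := hΩ.ae_eq_zero_of_integral_contDiff_smul_eq_zero (hu.sub hv) fun χ h1 h2 h3 => by
    rw [← setIntegral_eq_integral_of_forall_compl_eq_zero (s := Ω)]
    · have h4 : IsTest Ω χ := ⟨h1, h2, h3⟩
      have h5 := h χ h4
      rw [← sub_eq_zero, ← integral_sub (hint u hu χ h4) (hint v hv χ h4)] at h5
      rw [← h5]
      refine integral_congr_ae (Eventually.of_forall fun x => ?_)
      simp only [Pi.sub_apply, smul_eq_mul]; ring
    · intro x hx
      rw [image_eq_zero_of_notMem_tsupport fun h' => hx (h3 h'), zero_smul]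
  filter_upwards [this] with x hx hm
  exact sub_eq_zero.1 (hx hm)

/-- If `u_t = F` weakly on `[0,T] × Ω` with boundary values `w₀` at time `0` and `uT` at time `T`,
tested only with products, then `u` is the primitive of `F` with initial value `w₀`. -/
lemma eq_primitive_of_forall_integral_test {T : ℝ} (hT : 0 < T) {Ω : Set (Space d)}
    (hΩ : IsOpen Ω) {u F : ℝ → Space d → ℝ} {w₀ uT : Space d → ℝ}
    (hu : Integrable (fun q : ℝ × Space d => u q.1 q.2) (volume.restrict (Ioo 0 T ×ˢ Ω)))
    (hF : Integrable (fun q : ℝ × Space d => F q.1 q.2) (volume.restrict (Ioo 0 T ×ˢ Ω)))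
    (hw : IntegrableOn w₀ Ω) (huT : LocallyIntegrableOn uT Ω)
    (h : ∀ (η : ℝ → ℝ) (χ : Space d → ℝ), ContDiff ℝ ∞ η → HasCompactSupport η → IsTest Ω χ →
      (∫ q in Ioo 0 T ×ˢ Ω, u q.1 q.2 * (deriv η q.1 * χ q.2))
        - η T * (∫ x in Ω, uT x * χ x) + η 0 * (∫ x in Ω, w₀ x * χ x)
      = -∫ q in Ioo 0 T ×ˢ Ω, F q.1 q.2 * (η q.1 * χ q.2)) :
    (∀ᵐ q ∂(volume : Measure (ℝ × Space d)).restrict (Ioo 0 T ×ˢ Ω),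
      u q.1 q.2 = w₀ q.2 + ∫ s in (0 : ℝ)..q.1, F s q.2) ∧
    ∀ᵐ x ∂(volume.restrict Ω), uT x = w₀ x + ∫ s in (0 : ℝ)..T, F s x := by
  simp only [volume_restrict_prod] at hu hF h ⊢
  set I : Measure ℝ := volume.restrict (Ioo 0 T) with hI
  set μ : Measure (Space d) := volume.restrict Ω with hμ
  have mulχ : ∀ k : ℝ × Space d → ℝ, Integrable k (I.prod μ) → ∀ χ, IsTest Ω χ →
      Integrable (fun q => k q * χ q.2) (I.prod μ) := fun k hk χ hχ => by
    obtain ⟨C, hC⟩ := hχ.exists_bound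
    exact hk.mul_bdd (c := C) (hχ.1.continuous.comp continuous_snd).aestronglyMeasurable
      (Eventually.of_forall fun q => hC q.2)
  have mulη : ∀ k : ℝ × Space d → ℝ, Integrable k (I.prod μ) → ∀ η : ℝ → ℝ, Continuous η →
      HasCompactSupport η → Integrable (fun q => k q * η q.1) (I.prod μ) := fun k hk η hη hηc => by
    obtain ⟨C, hC⟩ := hηc.exists_bound_of_continuous hη
    exact hk.mul_bdd (c := C) (hη.comp continuous_fst).aestronglyMeasurable
      (Eventually.of_forall fun q => hC q.1)
  have fub : ∀ k : ℝ → Space d → ℝ, Integrable (fun q : ℝ × Space d => k q.1 q.2) (I.prod μ) →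
      ∀ χ, IsTest Ω χ → ∀ η : ℝ → ℝ, Continuous η → HasCompactSupport η →
      ∫ q, k q.1 q.2 * (η q.1 * χ q.2) ∂(I.prod μ) = ∫ t, (∫ x, k t x * χ x ∂μ) * η t ∂I := by
    intro k hk χ hχ η hη hηc
    have h1 := mulη _ (mulχ _ hk χ hχ) η hη hηc
    have h2 := integral_prod _ h1
    simp only [integral_mul_const] at h2
    rw [← h2]
    exact integral_congr_ae (Eventually.of_forall fun q => by simp only; ring)
  have swap : ∀ χ, IsTest Ω χ → ∀ t ∈ Icc 0 T,
      ∫ s in (0 : ℝ)..t, ∫ x, F s x * χ x ∂μ = ∫ x, (∫ s in (0 : ℝ)..t, F s x) * χ x ∂μ := by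
    intro χ hχ t ht
    have h1 := mulχ _ hF χ hχ
    have h2 : Integrable (fun q : ℝ × Space d => F q.1 q.2 * χ q.2)
        ((volume.restrict (Ioo 0 t)).prod μ) :=
      h1.mono_measure (Measure.prod_mono (Measure.restrict_mono (Ioo_subset_Ioo_right ht.2) le_rfl)
        le_rfl)
    rw [intervalIntegral.integral_of_le ht.1, integral_Ioc_eq_integral_Ioo,
      integral_integral_swap h2]
    refine integral_congr_ae (Eventually.of_forall fun x => ?_)
    simp only [integral_mul_const]
    rw [intervalIntegral.integral_of_le ht.1, integral_Ioc_eq_integral_Ioo]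
  -- Pairing with a fixed `χ` reduces the problem to one dimension; the exceptional null set of
  -- times still depends on `χ`.
  have oneD : ∀ χ, IsTest Ω χ →
      (∀ᵐ t ∂I, ∫ x, u t x * χ x ∂μ
        = (∫ x, w₀ x * χ x ∂μ) + ∫ s in (0 : ℝ)..t, ∫ x, F s x * χ x ∂μ) ∧
      ∫ x, uT x * χ x ∂μ
        = (∫ x, w₀ x * χ x ∂μ) + ∫ s in (0 : ℝ)..T, ∫ x, F s x * χ x ∂μ := by
    intro χ hχ
    refine eq_primitive_of_forall_integral_mul_deriv hT (mulχ _ hu χ hχ).integral_prod_left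
      (mulχ _ hF χ hχ).integral_prod_left fun η hη hηc => ?_
    have := h η χ hη hηc hχ
    rw [fub u hu χ hχ (deriv η) (hη.continuous_deriv (by simp)) hηc.deriv,
      fub F hF χ hχ η hη.continuous hηc] at this
    exact this
  have hmulχ : ∀ k : Space d → ℝ, Integrable k μ → ∀ χ, IsTest Ω χ →
      Integrable (fun x => k x * χ x) μ := fun k hk χ hχ => by
    obtain ⟨C, hC⟩ := hχ.exists_bound
    exact hk.mul_bdd (c := C) hχ.1.continuous.aestronglyMeasurable (Eventually.of_forall hC)
  have add : ∀ χ, IsTest Ω χ → ∀ t ∈ Icc 0 T,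
      (∫ x, w₀ x * χ x ∂μ) + ∫ s in (0 : ℝ)..t, ∫ x, F s x * χ x ∂μ
        = ∫ x, (w₀ x + ∫ s in (0 : ℝ)..t, F s x) * χ x ∂μ := by
    intro χ hχ t ht
    rw [swap χ hχ t ht, ← integral_add (hmulχ _ hw χ hχ)
      (hmulχ _ (integrable_primitive_right hF ht) χ hχ)]
    simp only [add_mul]
  constructor
  · set w : ℝ × Space d → ℝ := fun q =>
      u q.1 q.2 - (w₀ q.2 + ∫ s in (0 : ℝ)..q.1, F s q.2) with hwdef
    have hwi : Integrable w (I.prod μ) :=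
      hu.sub ((Integrable.comp_snd hw I).add (integrable_primitive hF))
    have hslice : ∀ χ, IsTest Ω χ → ∀ᵐ t ∂I, ∫ x, w (t, x) * χ x ∂μ = 0 := by
      intro χ hχ
      filter_upwards [(oneD χ hχ).1, ae_restrict_mem measurableSet_Ioo, hu.prod_right_ae] with
        t ht htm hut
      rw [add χ hχ t (Ioo_subset_Icc_self htm)] at ht
      simp only [hwdef, sub_mul]
      rw [integral_sub (hmulχ _ hut χ hχ) (hmulχ (fun x => w₀ x + ∫ s in (0 : ℝ)..t, F s x)
        (hw.add (integrable_primitive_right hF (Ioo_subset_Icc_self htm))) χ hχ), ht]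
      exact sub_self _
    -- Integrating over a set `A` of times before varying `χ` removes the dependence of the null
    -- sets on `χ`: the function `x ↦ ∫_A w(t,x) dt` is orthogonal to every test function. No
    -- countable dense family of test functions is needed.
    have hw0 : w =ᵐ[I.prod μ] 0 := by
      refine ae_eq_zero_of_setIntegral_prod_eq_zero hwi fun A B hA hB => ?_
      have hAi : Integrable w ((I.restrict A).prod μ) :=
        hwi.mono_measure (Measure.prod_mono Measure.restrict_le_self le_rfl)
      have hx : ∀ᵐ x ∂μ, ∫ t in A, w (t, x) ∂I = 0 := by
        refine ae_eq_of_forall_integral_test_eq (v := fun _ => 0) hΩ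
          (show IntegrableOn (fun x => ∫ t in A, w (t, x) ∂I) Ω volume from
            hAi.integral_prod_right).locallyIntegrableOn
          (integrableOn_zero.locallyIntegrableOn) fun χ hχ => ?_
        have h1 : Integrable (fun q : ℝ × Space d => w q * χ q.2) ((I.restrict A).prod μ) :=
          (mulχ _ hwi χ hχ).mono_measure (Measure.prod_mono Measure.restrict_le_self le_rfl)
        have h2 := integral_integral_swap (f := fun t x => w (t, x) * χ x) h1
        simp only [integral_mul_const] at h2
        change ∫ x, (∫ t in A, w (t, x) ∂I) * χ x ∂μ = _
        rw [← h2]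
        simp only [zero_mul, integral_zero]
        exact integral_eq_zero_of_ae (ae_restrict_of_ae (hslice χ hχ))
      rw [← Measure.prod_restrict, integral_prod_symm]
      · exact integral_eq_zero_of_ae (ae_restrict_of_ae hx)
      · exact hwi.mono_measure (Measure.prod_mono Measure.restrict_le_self Measure.restrict_le_self)
    filter_upwards [hw0] with q hq
    exact sub_eq_zero.1 hq
  · refine ae_eq_of_forall_integral_test_eq hΩ huT
      (show IntegrableOn (fun x => w₀ x + ∫ s in (0 : ℝ)..T, F s x) Ω from
        hw.add (integrable_primitive_right hF ⟨hT.le, le_rfl⟩)).locallyIntegrableOn fun χ hχ => ?_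
    rw [(oneD χ hχ).2, add χ hχ T ⟨hT.le, le_rfl⟩]

/-! ### Integrability of the terms of the equations -/

/-- The uniform bound on the spatial norms is integrated over a time measure of finite mass. -/
lemma memLp_two_prod {X : Type*} [MeasurableSpace X] {I : Measure ℝ} [IsFiniteMeasure I]
    {μ : Measure X} [SFinite μ] {f : ℝ → X → ℝ}
    (hf : AEStronglyMeasurable (fun q : ℝ × X => f q.1 q.2) (I.prod μ)) {C : ℝ}
    (hC : ∀ᵐ t ∂I, MemLp (f t) 2 μ ∧ ∫ x, f t x ^ 2 ∂μ ≤ C) :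
    MemLp (fun q : ℝ × X => f q.1 q.2) 2 (I.prod μ) := by
  rw [memLp_two_iff_integrable_sq hf]
  have hm : AEStronglyMeasurable (fun q : ℝ × X => f q.1 q.2 ^ 2) (I.prod μ) := hf.pow 2
  rw [integrable_prod_iff hm]
  refine ⟨hC.mono fun t ht => ht.1.integrable_sq, ?_⟩
  refine Integrable.of_bound (C := C) hm.norm.integral_prod_right' ?_
  filter_upwards [hC] with t ht
  simp only [norm_pow, Real.norm_eq_abs, sq_abs]
  rw [abs_of_nonneg (integral_nonneg fun _ => sq_nonneg _)]
  exact ht.2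

lemma aestronglyMeasurable_mat {X : Type*} [MeasurableSpace X] {μ : Measure X} {f : X → Mat d}
    (hf : ∀ i j, AEStronglyMeasurable (fun x => f x i j) μ) : AEStronglyMeasurable f μ := by
  let g : X → Fin d → Fin d → ℝ := f
  have hg : AEMeasurable g μ := aemeasurable_pi_iff.2 fun i => aemeasurable_pi_iff.2 fun j =>
    (hf i j).aemeasurable
  exact hg.aestronglyMeasurable

lemma aestronglyMeasurable_P (p : Params) {X : Type*} [MeasurableSpace X] {μ : Measure X}
    {f : X → Mat d} (hf : ∀ i j, AEStronglyMeasurable (fun x => f x i j) μ) (i j : Fin d) :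
    AEStronglyMeasurable (fun x => P p (f x) i j) μ := by
  have h := aestronglyMeasurable_mat hf
  have h1 : AEStronglyMeasurable (fun x => rFun p (f x)) μ :=
    (continuous_rFun p).comp_aestronglyMeasurable h
  have h2 : AEStronglyMeasurable (fun x => S p (f x) i j) μ :=
    (((continuous_S p).matrix_elem i j)).comp_aestronglyMeasurable h
  exact (h1.aemeasurable.inv.mul h2.aemeasurable).aestronglyMeasurable

lemma memLp_P {p : Params} (hp : p.Admissible d) {X : Type*} [MeasurableSpace X] {μ : Measure X}
    [IsFiniteMeasure μ] {f : X → Mat d} (hf : ∀ i j, MemLp (fun x => f x i j) 2 μ)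
    (hst : ∀ᵐ x ∂μ, SymTraceFree (f x)) (i j : Fin d) : MemLp (fun x => P p (f x) i j) 2 μ := by
  obtain ⟨C, hC, hP⟩ := exists_P_bound hp
  have hdom : MemLp (fun x => C * (1 + ∑ k, ∑ l, |f x k l|)) 2 μ :=
    ((memLp_const (1 : ℝ)).add (memLp_finsetSum _ fun k _ => memLp_finsetSum _ fun l _ =>
      (hf k l).abs)).const_mul C
  refine hdom.of_le (aestronglyMeasurable_P p (fun k l => (hf k l).1) i j) ?_
  filter_upwards [hst] with x hx
  refine (hP _ hx i j).trans (le_trans ?_ (le_abs_self _))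
  gcongr
  exact frob_le_sum_abs _

lemma integrable_dot {X : Type*} [MeasurableSpace X] {μ : Measure X} {f g : X → Mat d}
    (hf : ∀ i j, MemLp (fun x => f x i j) 2 μ) (hg : ∀ i j, MemLp (fun x => g x i j) 2 μ) :
    Integrable (fun x => dot (f x) (g x)) μ :=
  integrable_finsetSum _ fun i _ => integrable_finsetSum _ fun j _ => (hf i j).integrable_mul (hg i j)

lemma integrable_gradSq {μ : Measure (Space d)} {G : Fin d → Space d → Mat d}
    (hG : ∀ k i j, MemLp (fun x => G k x i j) 2 μ) : Integrable (gradSq G) μ :=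
  integrable_finsetSum _ fun k _ => integrable_dot (hG k) (hG k)

lemma gradSq_nonneg (G : Fin d → Space d → Mat d) (x : Space d) : 0 ≤ gradSq G x :=
  Finset.sum_nonneg fun _ _ => dot_self_nonneg _

lemma sq_entry_le_gradSq (G : Fin d → Space d → Mat d) (x : Space d) (k i j : Fin d) :
    G k x i j ^ 2 ≤ gradSq G x :=
  (sq_entry_le_dot_self _ i j).trans (Finset.single_le_sum (f := fun k => dot (G k x) (G k x))
    (fun _ _ => dot_self_nonneg _) (Finset.mem_univ k))

section LinftyH1

variable {Ω : Set (Space d)} {T : ℝ} {Q : ℝ → Space d → Mat d}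
  {DQ : ℝ → Fin d → Space d → Mat d}

lemma HasH1Gradient.integral_sq_le {A : Space d → Mat d} {G : Fin d → Space d → Mat d}
    (h : HasH1Gradient Ω A G) {C : ℝ} (hC : ∫ x in Ω, (dot (A x) (A x) + gradSq G x) ≤ C) :
    (∀ i j, ∫ x in Ω, A x i j ^ 2 ≤ C) ∧ ∀ k i j, ∫ x in Ω, G k x i j ^ 2 ≤ C := by
  have hi : IntegrableOn (fun x => dot (A x) (A x) + gradSq G x) Ω :=
    (integrable_dot h.memLp h.memLp).add (integrable_gradSq h.memLp_grad)
  constructor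
  · intro i j
    refine (integral_mono (h.memLp i j).integrable_sq hi fun x => ?_).trans hC
    exact (sq_entry_le_dot_self _ i j).trans (le_add_of_nonneg_right (gradSq_nonneg _ _))
  · intro k i j
    refine (integral_mono (h.memLp_grad k i j).integrable_sq hi fun x => ?_).trans hC
    exact (sq_entry_le_gradSq _ x k i j).trans (le_add_of_nonneg_left (dot_self_nonneg _))

lemma IsLinftyH1.memLp (h : IsLinftyH1 Ω T Q DQ) (i j : Fin d) :
    MemLp (fun q : ℝ × Space d => Q q.1 q.2 i j) 2 (volume.restrict (Ioo 0 T ×ˢ Ω)) := by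
  obtain ⟨C, hC⟩ := h.bound
  have hm := h.meas i j
  rw [volume_restrict_prod] at hm ⊢
  refine memLp_two_prod (f := fun t x => Q t x i j) hm (C := C) ?_
  filter_upwards [hC] with t ht using ⟨ht.1.memLp i j, (ht.1.integral_sq_le ht.2).1 i j⟩

lemma IsLinftyH1.memLp_grad (h : IsLinftyH1 Ω T Q DQ) (k i j : Fin d) :
    MemLp (fun q : ℝ × Space d => DQ q.1 k q.2 i j) 2 (volume.restrict (Ioo 0 T ×ˢ Ω)) := by
  obtain ⟨C, hC⟩ := h.bound
  have hm := h.meas_grad k i j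
  rw [volume_restrict_prod] at hm ⊢
  refine memLp_two_prod (f := fun t x => DQ t k x i j) hm (C := C) ?_
  filter_upwards [hC] with t ht using ⟨ht.1.memLp_grad k i j, (ht.1.integral_sq_le ht.2).2 k i j⟩

lemma IsLinftyL2.memLp {r : ℝ → Space d → ℝ} (h : IsLinftyL2 Ω T r) :
    MemLp (fun q : ℝ × Space d => r q.1 q.2) 2 (volume.restrict (Ioo 0 T ×ˢ Ω)) := by
  obtain ⟨C, hC⟩ := h.bound
  have hm := h.meas
  rw [volume_restrict_prod] at hm ⊢
  exact memLp_two_prod hm hC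

end LinftyH1

/-! ### Product test functions -/

lemma isTestST_mul {U : Set ℝ} {Ω : Set (Space d)} {η : ℝ → ℝ} {χ : Space d → ℝ}
    (hη : ContDiff ℝ ∞ η) (hηc : HasCompactSupport η) (hηU : tsupport η ⊆ U) (hχ : IsTest Ω χ) :
    IsTestST (U ×ˢ Ω) (fun t x => η t * χ x) := by
  have hsub : tsupport (fun q : ℝ × Space d => η q.1 * χ q.2) ⊆ tsupport η ×ˢ tsupport χ := by
    refine closure_minimal ?_ ((isClosed_tsupport η).prod (isClosed_tsupport χ))
    intro q hq
    exact ⟨subset_tsupport _ (left_ne_zero_of_mul hq), subset_tsupport _ (right_ne_zero_of_mul hq)⟩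
  refine ⟨(hη.comp contDiff_fst).mul (hχ.1.comp contDiff_snd), ?_, ?_⟩
  · exact (hηc.isCompact.prod hχ.2.1.isCompact).of_isClosed_subset (isClosed_tsupport _) hsub
  · exact hsub.trans (prod_mono hηU hχ.2.2)

lemma td_mul {η : ℝ → ℝ} {χ : Space d → ℝ} (hη : ContDiff ℝ ∞ η) (t : ℝ) (x : Space d) :
    td (fun t x => η t * χ x) t x = deriv η t * χ x :=
  deriv_mul_const (hη.differentiable (by simp)).differentiableAt _

/-- The matrix-valued test function `η(t) χ(x) E_ij`. -/
def singleTest (i j : Fin d) (η : ℝ → ℝ) (χ : Space d → ℝ) (t : ℝ) (x : Space d) : Mat d :=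
  Matrix.single i j (η t * χ x)

lemma isTestSTMat_singleTest {U : Set ℝ} {Ω : Set (Space d)} {η : ℝ → ℝ} {χ : Space d → ℝ}
    (hη : ContDiff ℝ ∞ η) (hηc : HasCompactSupport η) (hηU : tsupport η ⊆ U) (hχ : IsTest Ω χ)
    (i j : Fin d) : IsTestSTMat (U ×ˢ Ω) (singleTest i j η χ) := by
  intro k l
  simp only [singleTest, Matrix.single_apply]
  by_cases h : i = k ∧ j = l
  · simpa only [if_pos h] using isTestST_mul hη hηc hηU hχ
  · simp only [if_neg h]
    exact ⟨contDiff_const, HasCompactSupport.zero, by simp [tsupport]⟩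

lemma dot_single (A : Mat d) (i j : Fin d) (c : ℝ) : dot A (Matrix.single i j c) = A i j * c := by
  rw [dot, Finset.sum_eq_single i, Finset.sum_eq_single j]
  · simp
  · intro l _ hl; simp [hl.symm]
  · simp
  · intro k _ hk; simp [hk.symm]
  · simp

lemma tdMat_singleTest {η : ℝ → ℝ} {χ : Space d → ℝ} (hη : ContDiff ℝ ∞ η) (i j : Fin d) (t : ℝ)
    (x : Space d) : tdMat (singleTest i j η χ) t x = Matrix.single i j (deriv η t * χ x) := by
  ext k l
  simp only [tdMat, singleTest, Matrix.single_apply, Matrix.of_apply]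
  by_cases h : i = k ∧ j = l
  · simpa only [if_pos h] using td_mul hη t x
  · simp only [if_neg h, td, deriv_const]

/-- Only spatial derivatives of the test function occur, so its temporal factor pulls out. This lets
the equation for `Q` be read as an identity between integrals against `η`. -/
lemma elastic_singleTest (p : Params) (DQ : ℝ → Fin d → Space d → Mat d) {η : ℝ → ℝ}
    {χ : Space d → ℝ} (hχ : ContDiff ℝ ∞ χ) (i j : Fin d) (t : ℝ) (x : Space d) :
    elastic p DQ (singleTest i j η χ) t x
      = elastic p DQ (fun _ y => Matrix.single i j (χ y)) t x * η t := by
  have hpd : ∀ m k l, pd m (fun y => singleTest i j η χ t y k l) x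
      = η t * pd m (fun y => Matrix.single i j (χ y) k l) x := by
    intro m k l
    simp only [singleTest, Matrix.single_apply]
    by_cases h : i = k ∧ j = l
    · simp only [if_pos h, pd]
      rw [fderiv_const_mul (hχ.differentiable (by simp)).differentiableAt]; simp
    · simp [if_neg h, pd]
  simp only [elastic, hpd]
  rw [add_mul, mul_assoc, mul_assoc]
  simp only [Finset.sum_mul]
  congr 3
  · ext k; refine Finset.sum_congr rfl fun l _ => Finset.sum_congr rfl fun m _ => ?_; ring
  · ext k; refine Finset.sum_congr rfl fun l _ => Finset.sum_congr rfl fun m _ => ?_; ring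

lemma exists_pd_bound {Ω : Set (Space d)} {χ : Space d → ℝ} (hχ : IsTest Ω χ) (k : Fin d) :
    Continuous (pd k χ) ∧ ∃ C, ∀ x, ‖pd k χ x‖ ≤ C := by
  have hc : Continuous (pd k χ) :=
    (hχ.1.continuous_fderiv (by simp)).clm_apply continuous_const
  refine ⟨hc, HasCompactSupport.exists_bound_of_continuous ?_ hc⟩
  exact hχ.2.1.fderiv_apply (𝕜 := ℝ) _

lemma integrable_elastic_single (p : Params) {Ω : Set (Space d)} {T : ℝ}
    {DQ : ℝ → Fin d → Space d → Mat d} (hΩb : volume Ω < ⊤)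
    (hDQ : ∀ k i j, MemLp (fun q : ℝ × Space d => DQ q.1 k q.2 i j) 2
      (volume.restrict (Ioo 0 T ×ˢ Ω)))
    {χ : Space d → ℝ} (hχ : IsTest Ω χ) (i j : Fin d) :
    Integrable (fun q : ℝ × Space d => elastic p DQ (fun _ y => Matrix.single i j (χ y)) q.1 q.2)
      (volume.restrict (Ioo 0 T ×ˢ Ω)) := by
  have : IsFiniteMeasure (volume.restrict Ω) := ⟨by simpa using hΩb⟩
  have : IsFiniteMeasure ((volume : Measure (ℝ × Space d)).restrict (Ioo 0 T ×ˢ Ω)) := by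
    rw [volume_restrict_prod]; infer_instance
  have key : ∀ k a b m k' l', Integrable (fun q : ℝ × Space d => DQ q.1 k q.2 a b
      * pd m (fun y => Matrix.single i j (χ y) k' l') q.2) (volume.restrict (Ioo 0 T ×ˢ Ω)) := by
    intro k a b m k' l'
    simp only [Matrix.single_apply]
    by_cases h : i = k' ∧ j = l'
    · simp only [if_pos h]
      obtain ⟨hc, C, hC⟩ := exists_pd_bound hχ m
      exact ((hDQ k a b).integrable (by norm_num)).mul_bdd (c := C)
        (hc.comp continuous_snd).aestronglyMeasurable (Eventually.of_forall fun q => hC q.2)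
    · simp [if_neg h, pd]
  unfold elastic
  refine Integrable.add ?_ ?_
  · exact (integrable_finsetSum _ fun _ _ => integrable_finsetSum _ fun _ _ =>
      integrable_finsetSum _ fun _ _ => key _ _ _ _ _ _).const_mul _
  · exact (integrable_finsetSum _ fun _ _ => integrable_finsetSum _ fun _ _ =>
      integrable_finsetSum _ fun _ _ => ((key _ _ _ _ _ _).add (key _ _ _ _ _ _)).sub
        ((key _ _ _ _ _ _).const_mul _)).const_mul _

/-- Tests supported inside `(0,T)` already force the spatial integral of `k` to vanish at a.e. time;
after that `η` may take any values at the endpoints. -/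
lemma integral_mul_eq_zero_of_forall_test {X : Type*} [MeasurableSpace X] {μ : Measure X}
    [SFinite μ] {T : ℝ} {k : ℝ × X → ℝ} (hk : Integrable k ((volume.restrict (Ioo 0 T)).prod μ))
    (h : ∀ η : ℝ → ℝ, ContDiff ℝ ∞ η → HasCompactSupport η → tsupport η ⊆ Ioo 0 T →
      ∫ q, k q * η q.1 ∂((volume.restrict (Ioo 0 T)).prod μ) = 0)
    {η : ℝ → ℝ} (hη : ContDiff ℝ ∞ η) (hηc : HasCompactSupport η) :
    ∫ q, k q * η q.1 ∂((volume.restrict (Ioo 0 T)).prod μ) = 0 := by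
  have fub : ∀ η : ℝ → ℝ, ContDiff ℝ ∞ η → HasCompactSupport η →
      ∫ q, k q * η q.1 ∂((volume.restrict (Ioo 0 T)).prod μ)
        = ∫ t in Ioo 0 T, (∫ x, k (t, x) ∂μ) * η t := fun η hη hηc => by
    obtain ⟨C, hC⟩ := hηc.exists_bound_of_continuous hη.continuous
    have := hk.mul_bdd (g := fun q => η q.1) (c := C)
      (hη.continuous.measurable.comp measurable_fst).aestronglyMeasurable
      (Eventually.of_forall fun q => hC q.1)
    rw [integral_prod _ this]
    simp only [integral_mul_const]
  have hz : ∀ᵐ t : ℝ, t ∈ Ioo 0 T → ∫ x, k (t, x) ∂μ = 0 := by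
    refine isOpen_Ioo.ae_eq_zero_of_integral_contDiff_smul_eq_zero
      (show IntegrableOn (fun t => ∫ x, k (t, x) ∂μ) (Ioo 0 T) volume from
        hk.integral_prod_left).locallyIntegrableOn fun ζ h1 h2 h3 => ?_
    rw [← h ζ h1 h2 h3, fub ζ h1 h2, ← setIntegral_eq_integral_of_forall_compl_eq_zero (s := Ioo 0 T)]
    · simp only [smul_eq_mul, mul_comm]
    · intro t ht
      rw [image_eq_zero_of_notMem_tsupport fun h' => ht (h3 h'), zero_smul]
  rw [fub η hη hηc]
  refine integral_eq_zero_of_ae ?_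
  rw [EventuallyEq, ae_restrict_iff' measurableSet_Ioo]
  filter_upwards [hz] with t ht hm
  simp [ht hm]

/-! ### The solution as a primitive in time and the identity `g = r(Q)` -/

/-- `Q₀ + ∫_0^t Qt`. -/
def timePrimitive (Q₀ : Space d → Mat d) (Qt : ℝ → Space d → Mat d) (t : ℝ) (x : Space d) : Mat d :=
  Matrix.of fun i j => Q₀ x i j + ∫ s in (0 : ℝ)..t, Qt s x i j

lemma timePrimitive_zero (Q₀ : Space d → Mat d) (Qt : ℝ → Space d → Mat d) (x : Space d) :
    timePrimitive Q₀ Qt 0 x = Q₀ x := by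
  ext i j; simp [timePrimitive]

lemma Icc_subset_closure_of_ae {T : ℝ} (hT : 0 < T) {s : ℝ → Prop}
    (h : ∀ᵐ t ∂(volume.restrict (Ioo 0 T)), s t) : Icc 0 T ⊆ closure {t | t ∈ Ioo 0 T ∧ s t} := by
  rw [ae_restrict_iff' measurableSet_Ioo] at h
  have hd : Dense {t | t ∈ Ioo 0 T → s t} := Measure.dense_of_ae h
  have h1 : Ioo 0 T ⊆ closure (Ioo 0 T ∩ {t | t ∈ Ioo 0 T → s t}) :=
    hd.open_subset_closure_inter isOpen_Ioo
  have h2 : Ioo 0 T ∩ {t | t ∈ Ioo 0 T → s t} ⊆ {t | t ∈ Ioo 0 T ∧ s t} :=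
    fun t ht => ⟨ht.1, ht.2 ht.1⟩
  rw [← closure_Ioo hT.ne]
  exact closure_minimal (h1.trans (closure_mono h2)) isClosed_closure

section Reformulated

variable {p : Params} {Ω : Set (Space d)} {T : ℝ} {Q₀ : Space d → Mat d}
  {DQ₀ : Fin d → Space d → Mat d} {Q : ℝ → Space d → Mat d} {r : ℝ → Space d → ℝ}
  {DQ : ℝ → Fin d → Space d → Mat d} {Qt H : ℝ → Space d → Mat d}

lemma isFiniteMeasure_restrict_prod (hΩv : volume Ω < ⊤) :
    IsFiniteMeasure ((volume : Measure (ℝ × Space d)).restrict (Ioo 0 T ×ˢ Ω)) := by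
  have : IsFiniteMeasure (volume.restrict Ω) := ⟨by simpa using hΩv⟩
  rw [volume_restrict_prod]; infer_instance

lemma ReformulatedData.ae_symTraceFree (h : ReformulatedData p Ω T Q₀ DQ₀ Q r DQ Qt H)
    (hΩ : IsOpen Ω) : ∀ᵐ q ∂(volume : Measure (ℝ × Space d)).restrict (Ioo 0 T ×ˢ Ω),
      SymTraceFree (Q q.1 q.2) := by
  filter_upwards [ae_restrict_mem (measurableSet_Ioo.prod hΩ.measurableSet)] with q hq
  exact h.symTraceFree q.1 (Ioo_subset_Icc_self hq.1) q.2 hq.2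

lemma ReformulatedData.memLp_P (h : ReformulatedData p Ω T Q₀ DQ₀ Q r DQ Qt H)
    (hp : p.Admissible d) (hΩ : IsOpen Ω) (hΩv : volume Ω < ⊤) (i j : Fin d) :
    MemLp (fun q : ℝ × Space d => P p (Q q.1 q.2) i j) 2 (volume.restrict (Ioo 0 T ×ˢ Ω)) := by
  have := isFiniteMeasure_restrict_prod (T := T) hΩv
  exact QTensor.memLp_P hp (fun i j => h.linftyH1.memLp i j) (h.ae_symTraceFree hΩ) i j

lemma ReformulatedData.integrable_reaction (h : ReformulatedData p Ω T Q₀ DQ₀ Q r DQ Qt H)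
    (hp : p.Admissible d) (hΩ : IsOpen Ω) (hΩv : volume Ω < ⊤) (i j : Fin d) :
    Integrable (fun q : ℝ × Space d => (r q.1 q.2 • P p (Q q.1 q.2)) i j)
      (volume.restrict (Ioo 0 T ×ˢ Ω)) :=
  h.linftyL2.memLp.integrable_mul (h.memLp_P hp hΩ hΩv i j)

/-- The boundary terms of the weak equation for `Q` are those of its weak time derivative. -/
lemma ReformulatedData.weak_timeDeriv (h : ReformulatedData p Ω T Q₀ DQ₀ Q r DQ Qt H)
    (hp : p.Admissible d) (hΩ : IsOpen Ω) (hΩv : volume Ω < ⊤) (i j : Fin d)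
    {η : ℝ → ℝ} {χ : Space d → ℝ} (hη : ContDiff ℝ ∞ η) (hηc : HasCompactSupport η)
    (hχ : IsTest Ω χ) :
    (∫ q in Ioo 0 T ×ˢ Ω, Q q.1 q.2 i j * (deriv η q.1 * χ q.2))
        - η T * (∫ x in Ω, Q T x i j * χ x) + η 0 * (∫ x in Ω, Q₀ x i j * χ x)
      = -∫ q in Ioo 0 T ×ˢ Ω, Qt q.1 q.2 i j * (η q.1 * χ q.2) := by
  have := isFiniteMeasure_restrict_prod (T := T) hΩv
  set ν := (volume : Measure (ℝ × Space d)).restrict (Ioo 0 T ×ˢ Ω) with hν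
  obtain ⟨C, hC⟩ := hχ.exists_bound
  have mulχ : ∀ k : ℝ × Space d → ℝ, Integrable k ν → Integrable (fun q => k q * χ q.2) ν :=
    fun k hk => hk.mul_bdd (c := C) (hχ.1.continuous.comp continuous_snd).aestronglyMeasurable
      (Eventually.of_forall fun q => hC q.2)
  have mulη : ∀ k : ℝ × Space d → ℝ, Integrable k ν → ∀ η : ℝ → ℝ, ContDiff ℝ ∞ η →
      HasCompactSupport η → Integrable (fun q => k q * η q.1) ν := fun k hk η hη hηc => by
    obtain ⟨C, hC⟩ := hηc.exists_bound_of_continuous hη.continuous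
    exact hk.mul_bdd (c := C) (hη.continuous.comp continuous_fst).aestronglyMeasurable
      (Eventually.of_forall fun q => hC q.1)
  set e : ℝ × Space d → ℝ := fun q => elastic p DQ (fun _ y => Matrix.single i j (χ y)) q.1 q.2
  set R : ℝ × Space d → ℝ := fun q => (r q.1 q.2 • P p (Q q.1 q.2)) i j * χ q.2
  set W : ℝ × Space d → ℝ := fun q => Qt q.1 q.2 i j * χ q.2
  have he : Integrable e ν :=
    integrable_elastic_single p hΩv (fun k i j => h.linftyH1.memLp_grad k i j) hχ i j
  have hR : Integrable R ν := mulχ _ (h.integrable_reaction hp hΩ hΩv i j)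
  have hW : Integrable W ν := mulχ _ ((h.timeDeriv.memLp i j).integrable (by norm_num))
  have hK : Integrable (fun q => p.M * e q + p.M * R q) ν := (he.const_mul _).add (hR.const_mul _)
  have eqn : ∀ η : ℝ → ℝ, ContDiff ℝ ∞ η → HasCompactSupport η →
      (∫ q, Q q.1 q.2 i j * (deriv η q.1 * χ q.2) ∂ν)
        - η T * (∫ x in Ω, Q T x i j * χ x) + η 0 * (∫ x in Ω, Q₀ x i j * χ x)
      = ∫ q, (p.M * e q + p.M * R q) * η q.1 ∂ν := by
    intro η hη hηc
    have h1 := h.equation_Q (singleTest i j η χ)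
      (isTestSTMat_singleTest hη hηc (subset_univ _) hχ i j)
    simp only [tdMat_singleTest hη, elastic_singleTest p DQ hχ.1] at h1
    simp only [singleTest, dot_single] at h1
    simp only [add_mul]
    rw [integral_add (mulη _ (he.const_mul _) η hη hηc) (mulη _ (hR.const_mul _) η hη hηc)]
    simp only [mul_assoc, integral_const_mul]
    have e1 : ∀ f : Space d → ℝ, ∀ t, ∫ x in Ω, f x * (η t * χ x) = η t * ∫ x in Ω, f x * χ x :=
      fun f t => by
        rw [← integral_const_mul]
        exact integral_congr_ae (Eventually.of_forall fun x => by simp only; ring)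
    rw [e1 (fun x => Q T x i j), e1 (fun x => Q₀ x i j)] at h1
    rw [h1]
    congr 2
    exact integral_congr_ae (Eventually.of_forall fun q => by simp only [R]; ring)
  -- For tests vanishing at both ends, the weak equation and the definition of the weak time
  -- derivative have the same left-hand side. Their right-hand sides therefore agree on interior
  -- tests, and hence against every `η`.
  have hzero : ∫ q, (p.M * e q + p.M * R q + W q) * η q.1 ∂ν = 0 := by
    have hk : Integrable (fun q => p.M * e q + p.M * R q + W q) ν :=
      hK.add hW
    rw [hν, volume_restrict_prod] at hk ⊢
    refine integral_mul_eq_zero_of_forall_test hk ?_ hη hηc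
    rw [← volume_restrict_prod, ← hν]
    intro ζ h1 h2 h3
    have h4 := eqn ζ h1 h2
    have hT0 : ζ T = 0 := image_eq_zero_of_notMem_tsupport fun hm => (h3 hm).2.ne rfl
    have h00 : ζ 0 = 0 := image_eq_zero_of_notMem_tsupport fun hm => (h3 hm).1.ne rfl
    rw [hT0, h00, zero_mul, zero_mul, sub_zero, add_zero] at h4
    have h5 := h.timeDeriv.weak i j _ (isTestST_mul h1 h2 h3 hχ)
    simp only [td_mul h1] at h5
    simp only [add_mul _ (W _)]
    rw [integral_add (mulη _ hK ζ h1 h2)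
      (mulη _ hW ζ h1 h2)]
    have h6 : ∫ q, W q * ζ q.1 ∂ν = ∫ q, Qt q.1 q.2 i j * (ζ q.1 * χ q.2) ∂ν :=
      integral_congr_ae (Eventually.of_forall fun q => by simp only [W]; ring)
    rw [← h4, h6, h5]
    exact neg_add_cancel _
  rw [eqn η hη hηc]
  simp only [add_mul _ (W _)] at hzero
  rw [integral_add (mulη _ hK η hη hηc)
      (mulη _ hW η hη hηc)] at hzero
  have h6 : ∫ q, W q * η q.1 ∂ν = ∫ q, Qt q.1 q.2 i j * (η q.1 * χ q.2) ∂ν :=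
      integral_congr_ae (Eventually.of_forall fun q => by simp only [W]; ring)
  rw [h6] at hzero
  exact eq_neg_of_add_eq_zero_left hzero

lemma ReformulatedData.Q_eq_timePrimitive (h : ReformulatedData p Ω T Q₀ DQ₀ Q r DQ Qt H)
    (hp : p.Admissible d) (hΩ : IsOpen Ω) (hΩv : volume Ω < ⊤) (hT : 0 < T)
    (hQ₀ : ∀ i j, MemLp (fun x => Q₀ x i j) 2 (volume.restrict Ω)) :
    (∀ᵐ q ∂(volume : Measure (ℝ × Space d)).restrict (Ioo 0 T ×ˢ Ω),
      Q q.1 q.2 = timePrimitive Q₀ Qt q.1 q.2) ∧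
    ∀ᵐ x ∂(volume.restrict Ω), Q T x = timePrimitive Q₀ Qt T x := by
  have := isFiniteMeasure_restrict_prod (T := T) hΩv
  have : IsFiniteMeasure (volume.restrict Ω) := ⟨by simpa using hΩv⟩
  have key := fun i j => eq_primitive_of_forall_integral_test hT hΩ
    (u := fun t x => Q t x i j) (F := fun t x => Qt t x i j) (w₀ := fun x => Q₀ x i j)
    (uT := fun x => Q T x i j) ((h.linftyH1.memLp i j).integrable (by norm_num))
    ((h.timeDeriv.memLp i j).integrable (by norm_num)) ((hQ₀ i j).integrable (by norm_num))
    (h.final_Q i j) fun η χ hη hηc hχ => h.weak_timeDeriv hp hΩ hΩv i j hη hηc hχ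
  constructor
  · have h1 := ae_all_iff.2 fun i => ae_all_iff.2 fun j => (key i j).1
    filter_upwards [h1] with q hq
    ext i j; exact hq i j
  · have h1 := ae_all_iff.2 fun i => ae_all_iff.2 fun j => (key i j).2
    filter_upwards [h1] with x hx
    ext i j; exact hx i j

lemma ae_ae_of_ae_restrict_prod {s : ℝ → Space d → Prop}
    (h : ∀ᵐ q ∂(volume : Measure (ℝ × Space d)).restrict (Ioo 0 T ×ˢ Ω), s q.1 q.2) :
    (∀ᵐ t ∂(volume.restrict (Ioo 0 T)), ∀ᵐ x ∂(volume.restrict Ω), s t x) ∧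
    ∀ᵐ x ∂(volume.restrict Ω), ∀ᵐ t ∂(volume.restrict (Ioo 0 T)), s t x := by
  rw [volume_restrict_prod] at h
  exact ⟨Measure.ae_ae_of_ae_prod h,
    Measure.ae_ae_of_ae_prod (Measure.measurePreserving_swap.quasiMeasurePreserving.ae h)⟩

lemma ae_intervalIntegrable (hT : 0 < T) (hΩv : volume Ω < ⊤) (hQt : IsL2ST Ω T Qt) :
    ∀ᵐ x ∂(volume.restrict Ω), ∀ i j, IntervalIntegrable (fun s => Qt s x i j) volume 0 T := by
  have := isFiniteMeasure_restrict_prod (T := T) hΩv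
  rw [ae_all_iff]; intro i; rw [ae_all_iff]; intro j
  have h1 : Integrable (fun q : ℝ × Space d => Qt q.1 q.2 i j)
      (volume.restrict (Ioo 0 T ×ˢ Ω)) := (hQt i j).integrable (by norm_num)
  rw [volume_restrict_prod] at h1
  filter_upwards [ae_integrableOn_of_integrable_prod (F := fun t x => Qt t x i j) h1] with x hx
  rwa [intervalIntegrable_iff_integrableOn_Ioo_of_le hT.le]

lemma continuousOn_timePrimitive (hT : 0 < T) {x : Space d}
    (hx : ∀ i j, IntervalIntegrable (fun s => Qt s x i j) volume 0 T) :
    ContinuousOn (fun t => timePrimitive Q₀ Qt t x) (Icc 0 T) := by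
  refine continuousOn_pi.2 fun i => continuousOn_pi.2 fun j => ?_
  have := ((hx i j).absolutelyContinuousOnInterval_intervalIntegral left_mem_uIcc).continuousOn
  rw [uIcc_of_le hT.le] at this
  exact continuousOn_const.add this

/-- For a.e. `x` the constraint holds at a.e. time; continuity in time and closedness of the
constraint extend it to every time, as the pointwise chain rule requires. -/
lemma ReformulatedData.ae_symTraceFree_timePrimitive
    (h : ReformulatedData p Ω T Q₀ DQ₀ Q r DQ Qt H)
    (hp : p.Admissible d) (hΩ : IsOpen Ω) (hΩv : volume Ω < ⊤) (hT : 0 < T)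
    (hQ₀ : ∀ i j, MemLp (fun x => Q₀ x i j) 2 (volume.restrict Ω)) :
    ∀ᵐ x ∂(volume.restrict Ω), ∀ t ∈ Icc 0 T, SymTraceFree (timePrimitive Q₀ Qt t x) := by
  have h1 : ∀ᵐ q ∂(volume : Measure (ℝ × Space d)).restrict (Ioo 0 T ×ˢ Ω),
      SymTraceFree (timePrimitive Q₀ Qt q.1 q.2) := by
    filter_upwards [(h.Q_eq_timePrimitive hp hΩ hΩv hT hQ₀).1, h.ae_symTraceFree hΩ] with q h1 h2
    rwa [← h1]
  filter_upwards [(ae_ae_of_ae_restrict_prod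
    (s := fun t x => SymTraceFree (timePrimitive Q₀ Qt t x)) h1).2,
    ae_intervalIntegrable hT hΩv h.timeDeriv.memLp] with x hx hxi t ht
  have hc := continuousOn_timePrimitive (Q₀ := Q₀) hT hxi
  have hcl := Icc_subset_closure_of_ae hT hx
  have hsub : closure {t | t ∈ Ioo 0 T ∧ SymTraceFree (timePrimitive Q₀ Qt t x)} ⊆ Icc 0 T :=
    closure_minimal (fun s hs => Ioo_subset_Icc_self hs.1) isClosed_Icc
  have hm := MapsTo.closure_of_continuousWithinAt
    (f := fun t => timePrimitive Q₀ Qt t x)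
    (s := {t | t ∈ Ioo 0 T ∧ SymTraceFree (timePrimitive Q₀ Qt t x)})
    (t := {A | SymTraceFree A})
    (fun s hs => hs.2)
    (fun s hs => (hc s (hsub hs)).mono fun y hy => Ioo_subset_Icc_self hy.1)
  have := hm (hcl ht)
  rwa [isClosed_symTraceFree.closure_eq] at this

lemma ReformulatedData.r_eq_rFun (h : ReformulatedData p Ω T Q₀ DQ₀ Q r DQ Qt H)
    (hp : p.Admissible d) (hΩ : IsOpen Ω) (hΩv : volume Ω < ⊤) (hT : 0 < T)
    (hQ₀s : ∀ x ∈ Ω, SymTraceFree (Q₀ x))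
    (hQ₀ : ∀ i j, MemLp (fun x => Q₀ x i j) 2 (volume.restrict Ω)) :
    ∀ᵐ q ∂(volume : Measure (ℝ × Space d)).restrict (Ioo 0 T ×ˢ Ω),
      r q.1 q.2 = rFun p (Q q.1 q.2) := by
  have := isFiniteMeasure_restrict_prod (T := T) hΩv
  have : IsFiniteMeasure (volume.restrict Ω) := ⟨by simpa using hΩv⟩
  -- The quadratic growth of `r` matches `Q₀ ∈ L²`.
  have hr₀ : IntegrableOn (fun x => rFun p (Q₀ x)) Ω := by
    obtain ⟨C, hC, hb⟩ := exists_rFun_bound (d := d) p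
    have hdom : Integrable (fun x => C * (1 + dot (Q₀ x) (Q₀ x))) (volume.restrict Ω) :=
      ((integrable_const (1 : ℝ)).add (integrable_dot hQ₀ hQ₀)).const_mul C
    refine hdom.mono' ((continuous_rFun p).comp_aestronglyMeasurable
      (aestronglyMeasurable_mat fun i j => (hQ₀ i j).1)) ?_
    filter_upwards [ae_restrict_mem hΩ.measurableSet] with x hx
    rw [Real.norm_eq_abs, abs_of_pos (rFun_pos hp (hQ₀s x hx)), ← frob_sq]
    exact hb _ (hQ₀s x hx).1
  have key := (eq_primitive_of_forall_integral_test hT hΩ (u := r)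
    (F := fun t x => dot (P p (Q t x)) (Qt t x)) (w₀ := fun x => rFun p (Q₀ x)) (uT := r T)
    (h.linftyL2.memLp.integrable (by norm_num))
    (integrable_dot (h.memLp_P hp hΩ hΩv) h.timeDeriv.memLp) hr₀ h.final_r
    fun η χ hη hηc hχ => by
      have := h.equation_r _ (isTestST_mul hη hηc (subset_univ _) hχ)
      simp only [td_mul hη] at this
      rw [← this, ← integral_const_mul, ← integral_const_mul]
      congr 2 <;> [congr 1; skip] <;>
      · funext x; ring).1
  have hQV := h.Q_eq_timePrimitive hp hΩ hΩv hT hQ₀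
  -- The chain rule is applied for a.e. fixed `x` to the continuous primitive; inside the integral
  -- the primitive is replaced by `Q`, which has the same values at a.e. time.
  have hchain : ∀ᵐ x ∂(volume.restrict Ω), ∀ t ∈ Icc 0 T, rFun p (timePrimitive Q₀ Qt t x)
      = rFun p (Q₀ x) + ∫ s in (0 : ℝ)..t, dot (P p (Q s x)) (Qt s x) := by
    filter_upwards [h.ae_symTraceFree_timePrimitive hp hΩ hΩv hT hQ₀,
      ae_intervalIntegrable hT hΩv h.timeDeriv.memLp,
      (ae_ae_of_ae_restrict_prod (s := fun t x => Q t x = timePrimitive Q₀ Qt t x) hQV.1).2]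
      with x h1 h2 h3 t ht
    have := rFun_eq_integral hp (v := fun t => timePrimitive Q₀ Qt t x) (w := fun t => Qt t x)
      hT.le h2 (fun t _ i j => by simp [timePrimitive]) h1 t ht
    rw [this, timePrimitive_zero]
    congr 1
    rw [intervalIntegral.integral_of_le ht.1, intervalIntegral.integral_of_le ht.1,
      integral_Ioc_eq_integral_Ioo, integral_Ioc_eq_integral_Ioo]
    refine integral_congr_ae ?_
    filter_upwards [ae_restrict_of_ae_restrict_of_subset (Ioo_subset_Ioo_right ht.2) h3] with s hs
    rw [hs]
  have hchain' := ae_prod_of_ae_right (p := fun t x => rFun p (timePrimitive Q₀ Qt t x)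
      = rFun p (Q₀ x) + ∫ s in (0 : ℝ)..t, dot (P p (Q s x)) (Qt s x)) hchain
  rw [← volume_restrict_prod] at hchain'
  filter_upwards [key, hchain', hQV.1] with q h1 h2 h3
  rw [h1, h3, h2]

end Reformulated

/-! ### Continuity in time with values in `L²` -/

/-- Cauchy–Schwarz against the constant one, read off from `∫ (m f - a)² ≥ 0` with `m` the total
mass and `a` the integral of `f`. Zero mass is treated apart because the argument divides by `m`. -/
lemma sq_integral_le {X : Type*} [MeasurableSpace X] {μ : Measure X} [IsFiniteMeasure μ]
    {f : X → ℝ} (hf : MemLp f 2 μ) : (∫ x, f x ∂μ) ^ 2 ≤ μ.real univ * ∫ x, f x ^ 2 ∂μ := by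
  set m := μ.real univ with hm
  set a := ∫ x, f x ∂μ with ha
  have hfi : Integrable f μ := hf.integrable (by norm_num)
  have hf2 : Integrable (fun x => f x ^ 2) μ := hf.integrable_sq
  have h0 : 0 ≤ ∫ x, (m * f x - a) ^ 2 ∂μ := integral_nonneg fun _ => sq_nonneg _
  have h1 : ∫ x, (m * f x - a) ^ 2 ∂μ = m * (m * ∫ x, f x ^ 2 ∂μ - a ^ 2) := by
    have : ∀ x, (m * f x - a) ^ 2 = m ^ 2 * f x ^ 2 - 2 * m * a * f x + a ^ 2 := fun x => by ring
    have hsub : Integrable (fun x => m ^ 2 * f x ^ 2 - 2 * m * a * f x) μ :=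
      (hf2.const_mul _).sub (hfi.const_mul _)
    simp only [this]
    rw [integral_add hsub (integrable_const _),
      integral_sub (hf2.const_mul _) (hfi.const_mul _), integral_const_mul, integral_const_mul,
      integral_const, ← hm, ← ha, smul_eq_mul]
    ring
  rcases (measureReal_nonneg : 0 ≤ μ.real univ).eq_or_lt with h | h
  · have hμ : μ = 0 := by
      rw [eq_comm, measureReal_eq_zero_iff] at h
      exact Measure.measure_univ_eq_zero.1 h
    simp [ha, hμ]
  · rw [h1] at h0
    have := nonneg_of_mul_nonneg_right h0 h
    linarith

lemma sq_intervalIntegral_le {f : ℝ → ℝ} {T s t : ℝ} (hf : MemLp f 2 (volume.restrict (Ioo 0 T)))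
    (hs : s ∈ Icc 0 T) (ht : t ∈ Icc 0 T) :
    (∫ y in s..t, f y) ^ 2 ≤ |t - s| * ∫ y in Ioo 0 T, f y ^ 2 := by
  wlog hst : s ≤ t generalizing s t
  · have := this ht hs (le_of_not_ge hst)
    rwa [intervalIntegral.integral_symm, neg_sq, abs_sub_comm]
  rw [intervalIntegral.integral_of_le hst, integral_Ioc_eq_integral_Ioo]
  have hsub : Ioo s t ⊆ Ioo 0 T := Ioo_subset_Ioo hs.1 ht.2
  have h1 := sq_integral_le (hf.mono_measure (Measure.restrict_mono hsub le_rfl))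
  refine h1.trans ?_
  have h2 : (volume.restrict (Ioo s t)).real univ = |t - s| := by
    rw [abs_of_nonneg (sub_nonneg.2 hst)]
    simp [measureReal_restrict_apply, hst]
  rw [h2]
  gcongr
  · exact Eventually.of_forall fun _ => sq_nonneg _
  · exact hf.integrable_sq

section

variable {X : Type*} [MeasurableSpace X] {μ : Measure X} [SFinite μ] {T : ℝ} {F : ℝ → X → ℝ}

lemma ae_memLp_two_of_memLp_prod
    (hF : MemLp (fun q : ℝ × X => F q.1 q.2) 2 ((volume.restrict (Ioo 0 T)).prod μ)) :
    ∀ᵐ x ∂μ, MemLp (fun s => F s x) 2 (volume.restrict (Ioo 0 T)) := by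
  have h1 := (AEStronglyMeasurable.prodMk_left (hF.1.prod_swap))
  filter_upwards [hF.integrable_sq.prod_left_ae, h1] with x hx hm
  rw [memLp_two_iff_integrable_sq]
  · exact hx
  · exact hm

/-- Cauchy–Schwarz in time at a.e. `x`, integrated over space: primitives of `L²` functions are
Hölder continuous of exponent `1/2` with values in `L²`. -/
lemma memLp_intervalIntegral
    (hF : MemLp (fun q : ℝ × X => F q.1 q.2) 2 ((volume.restrict (Ioo 0 T)).prod μ))
    {s t : ℝ} (hs : s ∈ Icc 0 T) (ht : t ∈ Icc 0 T) :
    MemLp (fun x => ∫ y in s..t, F y x) 2 μ ∧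
      ∫ x, (∫ y in s..t, F y x) ^ 2 ∂μ
        ≤ |t - s| * ∫ q, F q.1 q.2 ^ 2 ∂((volume.restrict (Ioo 0 T)).prod μ) := by
  have hint : Integrable (fun x => ∫ y in Ioo 0 T, F y x ^ 2) μ :=
    hF.integrable_sq.integral_prod_right
  have hb : ∀ᵐ x ∂μ, (∫ y in s..t, F y x) ^ 2 ≤ |t - s| * ∫ y in Ioo 0 T, F y x ^ 2 := by
    filter_upwards [ae_memLp_two_of_memLp_prod hF] with x hx
    exact sq_intervalIntegral_le hx hs ht
  have hm : AEStronglyMeasurable (fun x => ∫ y in s..t, F y x) μ := by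
    refine ((aestronglyMeasurable_primitive_right hF.1 ht).sub
      (aestronglyMeasurable_primitive_right hF.1 hs)).congr ?_
    filter_upwards [ae_memLp_two_of_memLp_prod hF] with x hx
    have hi : ∀ t ∈ Icc 0 T, IntervalIntegrable (fun y => F y x) volume 0 t := fun t ht => by
      rw [intervalIntegrable_iff_integrableOn_Ioo_of_le ht.1]
      exact IntegrableOn.mono_set (hx.integrable (by norm_num)) (Ioo_subset_Ioo_right ht.2)
    exact intervalIntegral.integral_interval_sub_left (hi t ht) (hi s hs)
  have hsq : Integrable (fun x => (∫ y in s..t, F y x) ^ 2) μ := by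
    refine (hint.const_mul |t - s|).mono' (hm.pow 2) ?_
    filter_upwards [hb] with x hx
    rwa [Real.norm_eq_abs, abs_of_nonneg (sq_nonneg _)]
  refine ⟨(memLp_two_iff_integrable_sq hm).2 hsq, ?_⟩
  refine (integral_mono_ae hsq (hint.const_mul _) hb).trans (le_of_eq ?_)
  rw [integral_const_mul, integral_prod_symm _ hF.integrable_sq]

end

section Slices

variable {Ω : Set (Space d)} {T : ℝ} {Q₀ : Space d → Mat d} {Qt : ℝ → Space d → Mat d}

lemma memLp_timePrimitive (hQt : IsL2ST Ω T Qt)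
    (hQ₀ : ∀ i j, MemLp (fun x => Q₀ x i j) 2 (volume.restrict Ω)) {t : ℝ} (ht : t ∈ Icc 0 T)
    (i j : Fin d) : MemLp (fun x => timePrimitive Q₀ Qt t x i j) 2 (volume.restrict Ω) := by
  have h := hQt i j
  rw [volume_restrict_prod] at h
  exact (hQ₀ i j).add (memLp_intervalIntegral (F := fun t x => Qt t x i j) h
    ⟨le_rfl, ht.1.trans ht.2⟩ ht).1

lemma tendsto_timePrimitive (hT : 0 < T) (hΩv : volume Ω < ⊤) (hQt : IsL2ST Ω T Qt) {s : ℝ}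
    (hs : s ∈ Icc 0 T) :
    Tendsto (fun t => ∫ x in Ω, dot (timePrimitive Q₀ Qt t x - timePrimitive Q₀ Qt s x)
      (timePrimitive Q₀ Qt t x - timePrimitive Q₀ Qt s x)) (𝓝[Icc 0 T] s) (𝓝 0) := by
  set K : ℝ := ∑ i, ∑ j, ∫ q in Ioo 0 T ×ˢ Ω, Qt q.1 q.2 i j ^ 2
  have hlim : Tendsto (fun t => |t - s| * K) (𝓝[Icc 0 T] s) (𝓝 0) := by
    have : Continuous fun t : ℝ => |t - s| * K := by fun_prop
    have := (this.tendsto s).mono_left (nhdsWithin_le_nhds (s := Icc 0 T))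
    simpa using this
  refine squeeze_zero' (Eventually.of_forall fun t => integral_nonneg fun x => dot_self_nonneg _)
    ?_ hlim
  filter_upwards [self_mem_nhdsWithin] with t ht
  have hmem : ∀ i j, MemLp (fun q : ℝ × Space d => Qt q.1 q.2 i j) 2
      ((volume.restrict (Ioo 0 T)).prod (volume.restrict Ω)) := fun i j => by
    rw [← volume_restrict_prod]; exact hQt i j
  have key := fun i j => memLp_intervalIntegral (F := fun t x => Qt t x i j) (hmem i j) hs ht
  have heq : ∀ᵐ x ∂(volume.restrict Ω), dot (timePrimitive Q₀ Qt t x - timePrimitive Q₀ Qt s x)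
      (timePrimitive Q₀ Qt t x - timePrimitive Q₀ Qt s x)
      = ∑ i, ∑ j, (∫ y in s..t, Qt y x i j) ^ 2 := by
    filter_upwards [ae_intervalIntegrable hT hΩv hQt] with x hx
    refine Finset.sum_congr rfl fun i _ => Finset.sum_congr rfl fun j _ => ?_
    have hi : ∀ t ∈ Icc 0 T, IntervalIntegrable (fun y => Qt y x i j) volume 0 t := fun t ht =>
      (hx i j).mono_set (by
        rw [uIcc_of_le hT.le, uIcc_of_le ht.1]; exact Icc_subset_Icc_right ht.2)
    rw [← intervalIntegral.integral_interval_sub_left (hi t ht) (hi s hs)]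
    simp only [timePrimitive, Matrix.sub_apply, Matrix.of_apply]
    ring
  rw [integral_congr_ae heq, integral_finsetSum _ fun i _ => integrable_finsetSum _ fun j _ =>
    (key i j).1.integrable_sq, Finset.mul_sum]
  refine Finset.sum_le_sum fun i _ => ?_
  rw [integral_finsetSum _ fun j _ => (key i j).1.integrable_sq, Finset.mul_sum]
  refine Finset.sum_le_sum fun j _ => ?_
  rw [volume_restrict_prod]
  exact (key i j).2

lemma dot_self_eq_zero {A : Mat d} (h : dot A A = 0) : A = 0 := by
  ext i j
  have := sq_entry_le_dot_self A i j
  rw [h] at this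
  exact pow_eq_zero_iff (two_ne_zero) |>.1 (le_antisymm this (sq_nonneg _))

lemma dot_sub_self_le (A B C : Mat d) :
    dot (A - B) (A - B) ≤ 2 * dot (C - A) (C - A) + 2 * dot (C - B) (C - B) := by
  simp only [dot, Finset.mul_sum, ← Finset.sum_add_distrib, Matrix.sub_apply]
  refine Finset.sum_le_sum fun i _ => Finset.sum_le_sum fun j _ => ?_
  nlinarith [sq_nonneg ((C i j - A i j) + (C i j - B i j))]

/-- Two families that are continuous in time with values in `L²` and agree at almost every time
agree at every time. -/
lemma ae_eq_of_tendsto_of_ae {A B : ℝ → Space d → Mat d} (hT : 0 < T)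
    (hA : ∀ t ∈ Icc 0 T, ∀ i j, MemLp (fun x => A t x i j) 2 (volume.restrict Ω))
    (hB : ∀ t ∈ Icc 0 T, ∀ i j, MemLp (fun x => B t x i j) 2 (volume.restrict Ω))
    (hAc : ∀ s ∈ Icc 0 T, Tendsto (fun t => ∫ x in Ω, dot (A t x - A s x) (A t x - A s x))
      (𝓝[Icc 0 T] s) (𝓝 0))
    (hBc : ∀ s ∈ Icc 0 T, Tendsto (fun t => ∫ x in Ω, dot (B t x - B s x) (B t x - B s x))
      (𝓝[Icc 0 T] s) (𝓝 0))
    (hAB : ∀ᵐ t ∂(volume.restrict (Ioo 0 T)), ∀ᵐ x ∂(volume.restrict Ω), A t x = B t x)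
    {s : ℝ} (hs : s ∈ Icc 0 T) : ∀ᵐ x ∂(volume.restrict Ω), A s x = B s x := by
  set G := {t | t ∈ Ioo 0 T ∧ ∀ᵐ x ∂(volume.restrict Ω), A t x = B t x} with hG
  have hcl : s ∈ closure G := Icc_subset_closure_of_ae hT hAB hs
  have : (𝓝[G] s).NeBot := mem_closure_iff_nhdsWithin_neBot.1 hcl
  have hle : 𝓝[G] s ≤ 𝓝[Icc 0 T] s := nhdsWithin_mono _ fun t ht => Ioo_subset_Icc_self ht.1
  have hsub : ∀ {U V : ℝ → Space d → Mat d} {t t' : ℝ},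
      (∀ i j, MemLp (fun x => U t x i j) 2 (volume.restrict Ω)) →
      (∀ i j, MemLp (fun x => V t' x i j) 2 (volume.restrict Ω)) →
      Integrable (fun x => dot (U t x - V t' x) (U t x - V t' x)) (volume.restrict Ω) :=
    fun hU hV => integrable_dot (fun i j => (hU i j).sub (hV i j)) fun i j => (hU i j).sub (hV i j)
  have hint := hsub (hA s hs) (hB s hs)
  have hlim := ((hAc s hs).const_mul 2 |>.add ((hBc s hs).const_mul 2)).mono_left hle
  simp only [mul_zero, add_zero] at hlim
  have hle0 : ∫ x in Ω, dot (A s x - B s x) (A s x - B s x) ≤ 0 := by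
    refine ge_of_tendsto hlim ?_
    filter_upwards [self_mem_nhdsWithin] with t ht
    have htI := Ioo_subset_Icc_self ht.1
    rw [← integral_const_mul, ← integral_const_mul, ← integral_add
      ((hsub (hA t htI) (hA s hs)).const_mul 2) ((hsub (hB t htI) (hB s hs)).const_mul 2)]
    refine integral_mono_ae hint (((hsub (hA t htI) (hA s hs)).const_mul 2).add
      ((hsub (hB t htI) (hB s hs)).const_mul 2)) ?_
    filter_upwards [ht.2] with x hx
    have := dot_sub_self_le (A s x) (B s x) (A t x)
    rw [hx] at this
    simpa only [hx, Pi.add_apply] using this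
  have h0 := (integral_eq_zero_iff_of_nonneg (fun x => dot_self_nonneg _) hint).1
    (le_antisymm hle0 (integral_nonneg fun x => dot_self_nonneg _))
  filter_upwards [h0] with x hx
  exact sub_eq_zero.1 (dot_self_eq_zero hx)

end Slices

/-! ### Existence and uniqueness of the time-continuous representative -/

section Representative

variable {p : Params} {Ω : Set (Space d)} {T : ℝ} {Q₀ : Space d → Mat d}
  {DQ₀ : Fin d → Space d → Mat d} {Q : ℝ → Space d → Mat d} {r : ℝ → Space d → ℝ}
  {DQ : ℝ → Fin d → Space d → Mat d} {Qt H : ℝ → Space d → Mat d}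

lemma ReformulatedData.exists_isContinuousRepresentative
    (h : ReformulatedData p Ω T Q₀ DQ₀ Q r DQ Qt H)
    (hp : p.Admissible d) (hΩ : IsOpen Ω) (hΩv : volume Ω < ⊤) (hT : 0 < T)
    (hQ₀ : ∀ i j, MemLp (fun x => Q₀ x i j) 2 (volume.restrict Ω)) :
    ∃ Q', IsContinuousRepresentative Ω T Q Q' := by
  classical
  have hst := h.ae_symTraceFree_timePrimitive hp hΩ hΩv hT hQ₀
  have hQV := (h.Q_eq_timePrimitive hp hΩ hΩv hT hQ₀).1
  -- Symmetry and zero trace are required at every point, so the primitive is replaced by `0` on the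
  -- null set of `x` where they fail at some time. That set does not depend on `t`, so continuity in
  -- `L²` survives.
  let Q' : ℝ → Space d → Mat d := fun t x =>
    if ∀ s ∈ Icc 0 T, SymTraceFree (timePrimitive Q₀ Qt s x) then timePrimitive Q₀ Qt t x else 0
  have hQ' : ∀ᵐ x ∂(volume.restrict Ω), ∀ t, Q' t x = timePrimitive Q₀ Qt t x := by
    filter_upwards [hst] with x hx t using if_pos hx
  refine ⟨Q', ⟨?_, ?_, ?_, ?_⟩⟩
  · have h1 := ae_prod_of_ae_right (T := T) (p := fun t x => Q' t x = timePrimitive Q₀ Qt t x)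
      (hQ'.mono fun x hx t _ => hx t)
    rw [← volume_restrict_prod] at h1
    filter_upwards [h1, hQV] with q h1 h2
    rw [h1, h2]
  · intro t ht x _
    by_cases hx : ∀ s ∈ Icc 0 T, SymTraceFree (timePrimitive Q₀ Qt s x)
    · simpa only [Q', if_pos hx] using hx t ht
    · simp only [Q', if_neg hx]
      exact ⟨Matrix.isSymm_zero, by simp⟩
  · intro t ht i j
    refine (memLp_timePrimitive h.timeDeriv.memLp hQ₀ ht i j).ae_eq ?_
    filter_upwards [hQ'] with x hx
    rw [hx]
  · intro s hs
    refine (tendsto_timePrimitive (Q₀ := Q₀) hT hΩv h.timeDeriv.memLp hs).congr fun t => ?_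
    refine integral_congr_ae ?_
    filter_upwards [hQ'] with x hx
    rw [hx, hx]

lemma ReformulatedData.representative_eq (h : ReformulatedData p Ω T Q₀ DQ₀ Q r DQ Qt H)
    (hp : p.Admissible d) (hΩ : IsOpen Ω) (hΩv : volume Ω < ⊤) (hT : 0 < T)
    (hQ₀ : ∀ i j, MemLp (fun x => Q₀ x i j) 2 (volume.restrict Ω)) {Q' : ℝ → Space d → Mat d}
    (hQ' : IsContinuousRepresentative Ω T Q Q') {t : ℝ} (ht : t ∈ Icc 0 T) :
    ∀ᵐ x ∂(volume.restrict Ω), Q' t x = timePrimitive Q₀ Qt t x := by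
  refine ae_eq_of_tendsto_of_ae hT hQ'.memLp
    (fun t ht => memLp_timePrimitive h.timeDeriv.memLp hQ₀ ht) hQ'.continuous
    (fun s hs => tendsto_timePrimitive hT hΩv h.timeDeriv.memLp hs) ?_ ht
  refine (ae_ae_of_ae_restrict_prod (s := fun t x => Q' t x = timePrimitive Q₀ Qt t x) ?_).1
  filter_upwards [hQ'.ae_eq, (h.Q_eq_timePrimitive hp hΩ hΩv hT hQ₀).1] with q h1 h2
  rw [h1, h2]

end Representative

/-! ### Weak compactness and lower semicontinuity -/

/-- Bounded families in `L²` converge weakly along ultrafilters. -/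
lemma exists_weak_limit {ι X : Type*} [MeasurableSpace X] {μ : Measure X} (𝒰 : Ultrafilter ι)
    {f : ι → X → ℝ} {C : ℝ} (hf : ∀ i, MemLp (f i) 2 μ) (hC : ∀ i, ∫ x, f i x ^ 2 ∂μ ≤ C) :
    ∃ g : X → ℝ, MemLp g 2 μ ∧ ∀ v : X → ℝ, MemLp v 2 μ →
      Tendsto (fun i => ∫ x, f i x * v x ∂μ) 𝒰 (𝓝 (∫ x, g x * v x ∂μ)) := by
  have inner_eq : ∀ (u v : X → ℝ) (hu : MemLp u 2 μ) (hv : MemLp v 2 μ),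
      inner ℝ (hu.toLp u) (hv.toLp v) = ∫ x, u x * v x ∂μ := fun u v hu hv => by
    rw [L2.inner_def]
    refine integral_congr_ae ?_
    filter_upwards [hu.coeFn_toLp, hv.coeFn_toLp] with x h1 h2
    rw [h1, h2]; simp [mul_comm]
  set F : ι → Lp ℝ 2 μ := fun i => (hf i).toLp (f i)
  have hnorm : ∀ i, ‖F i‖ ≤ Real.sqrt C := fun i => by
    refine Real.le_sqrt_of_sq_le ?_
    rw [← real_inner_self_eq_norm_sq, inner_eq]
    simpa only [sq] using hC i
  -- The Riesz isometry moves the bounded family into the dual, where the Banach–Alaoglu theorem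
  -- applies. With an ultrafilter no subsequences have to be extracted entry by entry.
  set Φ : ι → WeakDual ℝ (Lp ℝ 2 μ) := fun i =>
    StrongDual.toWeakDual (InnerProductSpace.toDual ℝ (Lp ℝ 2 μ) (F i))
  have hK := WeakDual.isCompact_closedBall (𝕜 := ℝ) (E := Lp ℝ 2 μ) 0 (Real.sqrt C)
  have hmem : ∀ i, Φ i ∈ (WeakDual.toStrongDual ⁻¹'
      Metric.closedBall (0 : StrongDual ℝ (Lp ℝ 2 μ)) (Real.sqrt C)) := fun i => by
    rw [mem_preimage, Metric.mem_closedBall, dist_zero_right]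
    exact ((InnerProductSpace.toDual ℝ (Lp ℝ 2 μ)).norm_map (F i)).trans_le (hnorm i)
  obtain ⟨φ, -, hφ⟩ := hK.ultrafilter_le_nhds (𝒰.map Φ)
    (le_principal_iff.2 (Eventually.of_forall (f := (𝒰 : Filter ι)) hmem))
  set G : Lp ℝ 2 μ := (InnerProductSpace.toDual ℝ (Lp ℝ 2 μ)).symm (WeakDual.toStrongDual φ)
  refine ⟨G, Lp.memLp G, fun v hv => ?_⟩
  have h1 : Tendsto (fun i => Φ i (hv.toLp v)) 𝒰 (𝓝 (φ (hv.toLp v))) :=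
    ((WeakDual.eval_continuous (𝕜 := ℝ) (hv.toLp v)).tendsto φ).comp hφ
  have h2 : φ (hv.toLp v) = ∫ x, G x * v x ∂μ := by
    rw [← inner_eq _ _ (Lp.memLp G) hv, Lp.toLp_coeFn]
    exact (InnerProductSpace.toDual_symm_apply (𝕜 := ℝ)).symm
  rw [← h2]
  refine h1.congr fun i => ?_
  rw [← inner_eq _ _ (hf i) hv]
  rfl

/-- Weak lower semicontinuity of the `L²` norm, in the form of convergent minorants. -/
lemma exists_minorant_integral_sq {ι X : Type*} [MeasurableSpace X] {μ : Measure X} {l : Filter ι}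
    {f : ι → X → ℝ} {g : X → ℝ} (hf : ∀ i, MemLp (f i) 2 μ) (hg : MemLp g 2 μ)
    (h : Tendsto (fun i => ∫ x, f i x * g x ∂μ) l (𝓝 (∫ x, g x * g x ∂μ))) :
    ∃ m : ι → ℝ, (∀ i, m i ≤ ∫ x, f i x ^ 2 ∂μ) ∧ Tendsto m l (𝓝 (∫ x, g x ^ 2 ∂μ)) := by
  -- The minorant comes from `2 f g - g² ≤ f²` and is affine in `f`, so weak convergence suffices.
  refine ⟨fun i => 2 * (∫ x, f i x * g x ∂μ) - ∫ x, g x ^ 2 ∂μ, fun i => ?_, ?_⟩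
  · have h1 : Integrable (fun x => f i x * g x) μ := (hf i).integrable_mul hg
    simp only
    rw [← integral_const_mul, ← integral_sub (h1.const_mul 2) hg.integrable_sq]
    refine integral_mono ((h1.const_mul 2).sub hg.integrable_sq) (hf i).integrable_sq fun x => ?_
    simp only
    nlinarith [sq_nonneg (f i x - g x)]
  · have := (h.const_mul 2).sub_const (∫ x, g x ^ 2 ∂μ)
    convert this using 2
    simp only [sq]; ring

/-- Fatou's lemma, in the form of convergent minorants. -/
lemma exists_minorant_integral {X : Type*} [MeasurableSpace X] {μ : Measure X} {f : ℕ → X → ℝ}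
    {g : X → ℝ} {K : ℝ} (hf : ∀ n, Integrable (f n) μ) (h0 : ∀ᵐ x ∂μ, ∀ n, 0 ≤ f n x)
    (hK : ∀ n, ∫ x, f n x ∂μ ≤ K)
    (hlim : ∀ᵐ x ∂μ, Tendsto (fun n => f n x) atTop (𝓝 (g x))) :
    Integrable g μ ∧ ∃ m : ℕ → ℝ, (∀ n, m n ≤ ∫ x, f n x ∂μ) ∧
      Tendsto m atTop (𝓝 (∫ x, g x ∂μ)) := by
  have hg0 : ∀ᵐ x ∂μ, 0 ≤ g x := by
    filter_upwards [h0, hlim] with x h1 h2 using ge_of_tendsto' h2 h1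
  have hgm : AEStronglyMeasurable g μ :=
    aestronglyMeasurable_of_tendsto_ae atTop (fun n => (hf n).1) hlim
  have hgi : Integrable g μ := by
    refine ⟨hgm, ?_⟩
    rw [hasFiniteIntegral_iff_ofReal hg0]
    have h1 : ∫⁻ x, ENNReal.ofReal (g x) ∂μ
        = ∫⁻ x, liminf (fun n => ENNReal.ofReal (f n x)) atTop ∂μ := by
      refine lintegral_congr_ae ?_
      filter_upwards [hlim] with x hx
      exact ((ENNReal.tendsto_ofReal hx).liminf_eq).symm
    rw [h1]
    refine (lintegral_liminf_le' fun n => (hf n).1.aemeasurable.ennreal_ofReal).trans_lt ?_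
    refine lt_of_le_of_lt (b := ENNReal.ofReal K) ?_ ENNReal.ofReal_lt_top
    refine liminf_le_of_frequently_le' (Frequently.of_forall fun n => ?_)
    rw [← ofReal_integral_eq_lintegral_ofReal (hf n) (h0.mono fun x hx => hx n)]
    exact ENNReal.ofReal_le_ofReal (hK n)
  -- Once `g` is known to be integrable, it dominates the truncations `min (f n) g`, whose integrals
  -- therefore converge.
  refine ⟨hgi, fun n => ∫ x, min (f n x) (g x) ∂μ, fun n => ?_, ?_⟩
  · exact integral_mono ((hf n).inf hgi) (hf n) fun x => min_le_left _ _
  · refine tendsto_integral_of_dominated_convergence g (fun n => ((hf n).inf hgi).1) hgi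
      (fun n => ?_) ?_
    · filter_upwards [h0, hg0] with x h1 h2
      rw [Real.norm_eq_abs, abs_of_nonneg (le_min (h1 n) h2)]
      exact min_le_right _ _
    · filter_upwards [hlim] with x hx
      simpa using hx.min (tendsto_const_nhds (x := g x))

lemma integral_elastic_energy {μ : Measure (Space d)} {G : Fin d → Space d → Mat d}
    (hG : ∀ k i j, MemLp (fun x => G k x i j) 2 μ) (a b : ℝ) :
    Integrable (fun x => a * gradSq G x + b * divSq G x) μ ∧
    ∫ x, (a * gradSq G x + b * divSq G x) ∂μ
      = a * (∑ k, ∑ i, ∑ j, ∫ x, G k x i j ^ 2 ∂μ) + b * ∑ j, ∫ x, (∑ i, G i x i j) ^ 2 ∂μ := by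
  have h1 : Integrable (gradSq G) μ := integrable_gradSq hG
  have hdiv : ∀ j, MemLp (fun x => ∑ i, G i x i j) 2 μ := fun j =>
    memLp_finsetSum _ fun i _ => hG i i j
  have h2 : Integrable (divSq G) μ := integrable_finsetSum _ fun j _ => (hdiv j).integrable_sq
  refine ⟨(h1.const_mul a).add (h2.const_mul b), ?_⟩
  rw [integral_add (h1.const_mul a) (h2.const_mul b), integral_const_mul, integral_const_mul]
  congr 2
  · simp only [gradSq, dot, ← sq]
    rw [integral_finsetSum _ fun k _ => integrable_finsetSum _ fun i _ =>
      integrable_finsetSum _ fun j _ => (hG k i j).integrable_sq]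
    refine Finset.sum_congr rfl fun k _ => ?_
    rw [integral_finsetSum _ fun i _ => integrable_finsetSum _ fun j _ => (hG k i j).integrable_sq]
    refine Finset.sum_congr rfl fun i _ => ?_
    rw [integral_finsetSum _ fun j _ => (hG k i j).integrable_sq]
  · exact integral_finsetSum _ fun j _ => (hdiv j).integrable_sq

/-- Weak lower semicontinuity of the elastic energy. -/
lemma exists_minorant_elastic_energy {ι : Type*} {μ : Measure (Space d)} {l : Filter ι}
    {f : ι → Fin d → Space d → Mat d} {G : Fin d → Space d → Mat d}
    (hf : ∀ n k i j, MemLp (fun x => f n k x i j) 2 μ)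
    (hG : ∀ k i j, MemLp (fun x => G k x i j) 2 μ)
    (hlim : ∀ k i j (v : Space d → ℝ), MemLp v 2 μ →
      Tendsto (fun n => ∫ x, f n k x i j * v x ∂μ) l (𝓝 (∫ x, G k x i j * v x ∂μ)))
    {a b : ℝ} (ha : 0 ≤ a) (hb : 0 ≤ b) :
    ∃ m : ι → ℝ, (∀ n, m n ≤ ∫ x, (a * gradSq (f n) x + b * divSq (f n) x) ∂μ) ∧
      Tendsto m l (𝓝 (∫ x, (a * gradSq G x + b * divSq G x) ∂μ)) := by
  have hgrad := fun k i j => exists_minorant_integral_sq (fun n => hf n k i j) (hG k i j)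
    (hlim k i j _ (hG k i j))
  have hdivG : ∀ j, MemLp (fun x => ∑ i, G i x i j) 2 μ := fun j =>
    memLp_finsetSum _ fun i _ => hG i i j
  have hdiv := fun j => exists_minorant_integral_sq
    (f := fun n x => ∑ i, f n i x i j) (g := fun x => ∑ i, G i x i j) (l := l)
    (fun n => memLp_finsetSum _ fun i _ => hf n i i j) (hdivG j) (by
      simp only [Finset.sum_mul _ _ (∑ i, G i _ i j)]
      have h1 : ∀ n, ∫ x, ∑ i', f n i' x i' j * ∑ i, G i x i j ∂μ
          = ∑ i', ∫ x, f n i' x i' j * ∑ i, G i x i j ∂μ := fun n =>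
        integral_finsetSum _ fun i' _ => (hf n i' i' j).integrable_mul (hdivG j)
      have h2 : ∫ x, ∑ i', G i' x i' j * ∑ i, G i x i j ∂μ
          = ∑ i', ∫ x, G i' x i' j * ∑ i, G i x i j ∂μ :=
        integral_finsetSum _ fun i' _ => (hG i' i' j).integrable_mul (hdivG j)
      simp only [h1, h2]
      exact tendsto_finsetSum _ fun i' _ => hlim i' i' j _ (hdivG j))
  choose m₁ hm₁ ht₁ using hgrad
  choose m₂ hm₂ ht₂ using hdiv
  refine ⟨fun n => a * (∑ k, ∑ i, ∑ j, m₁ k i j n) + b * ∑ j, m₂ j n, fun n => ?_, ?_⟩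
  · rw [(integral_elastic_energy (hf n) a b).2]
    exact add_le_add
      (mul_le_mul_of_nonneg_left (Finset.sum_le_sum fun k _ => Finset.sum_le_sum fun i _ =>
        Finset.sum_le_sum fun j _ => hm₁ k i j n) ha)
      (mul_le_mul_of_nonneg_left (Finset.sum_le_sum fun j _ => hm₂ j n) hb)
  · rw [(integral_elastic_energy hG a b).2]
    exact ((tendsto_finsetSum _ fun k _ => tendsto_finsetSum _ fun i _ =>
      tendsto_finsetSum _ fun j _ => ht₁ k i j).const_mul a).add
      ((tendsto_finsetSum _ fun j _ => ht₂ j).const_mul b)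

lemma continuousOn_setIntegral_Ioo_prod {Ω : Set (Space d)} {T : ℝ} (hT : 0 < T)
    {k : ℝ × Space d → ℝ} (hk : Integrable k (volume.restrict (Ioo 0 T ×ˢ Ω))) :
    ContinuousOn (fun t => ∫ q in Ioo 0 t ×ˢ Ω, k q) (Icc 0 T) := by
  rw [volume_restrict_prod] at hk
  have hi : IntervalIntegrable (fun t => ∫ x in Ω, k (t, x)) volume 0 T := by
    rw [intervalIntegrable_iff_integrableOn_Ioo_of_le hT.le]
    exact hk.integral_prod_left
  have hc := (hi.absolutelyContinuousOnInterval_intervalIntegral left_mem_uIcc).continuousOn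
  rw [uIcc_of_le hT.le] at hc
  refine hc.congr fun t ht => ?_
  simp only
  rw [volume_restrict_prod, integral_prod, intervalIntegral.integral_of_le ht.1,
    integral_Ioc_eq_integral_Ioo]
  exact hk.mono_measure (Measure.prod_mono
    (Measure.restrict_mono (Ioo_subset_Ioo_right ht.2) le_rfl) le_rfl)

/-! ### The energy inequality at every time -/

lemma HasH1Gradient.congr {Ω : Set (Space d)} {A B : Space d → Mat d} {G : Fin d → Space d → Mat d}
    (h : HasH1Gradient Ω A G) (hAB : ∀ᵐ x ∂(volume.restrict Ω), A x = B x) :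
    HasH1Gradient Ω B G where
  memLp i j := (h.memLp i j).ae_eq (hAB.mono fun x hx => by rw [hx])
  memLp_grad := h.memLp_grad
  weak k i j φ hφ := by
    rw [← h.weak k i j φ hφ]
    exact integral_congr_ae (hAB.mono fun x hx => by simp only [hx])

/-- At time `t` the primitive `V = Q₀ + ∫ Qt` lies in `H¹(Ω)` with weak gradient `G` and satisfies
the energy inequality. -/
structure EnergyAt (p : Params) (Ω : Set (Space d)) (Q₀ : Space d → Mat d)
    (DQ₀ : Fin d → Space d → Mat d) (Qt H : ℝ → Space d → Mat d) (t : ℝ)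
    (G : Fin d → Space d → Mat d) : Prop where
  grad : HasH1Gradient Ω (timePrimitive Q₀ Qt t) G
  integrable : IntegrableOn (fun x => bulk p (timePrimitive Q₀ Qt t x) + p.A₀) Ω
  energy : 1 / 2 * (∫ x in Ω, (p.L₁ * gradSq G x + (p.L₂ + p.L₃) * divSq G x
        + 2 * (bulk p (timePrimitive Q₀ Qt t x) + p.A₀)))
      ≤ 1 / 2 * (∫ x in Ω, (p.L₁ * gradSq DQ₀ x + (p.L₂ + p.L₃) * divSq DQ₀ x
          + (rFun p (Q₀ x)) ^ 2))
        - p.M * ∫ q in Ioo 0 t ×ˢ Ω, dot (H q.1 q.2) (H q.1 q.2)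

section

variable {p : Params} {Ω : Set (Space d)} {T : ℝ} {Q₀ : Space d → Mat d}
  {DQ₀ : Fin d → Space d → Mat d} {Q : ℝ → Space d → Mat d} {r : ℝ → Space d → ℝ}
  {DQ : ℝ → Fin d → Space d → Mat d} {Qt H : ℝ → Space d → Mat d}

lemma EnergyAt.integral_eq {t : ℝ} {G : Fin d → Space d → Mat d}
    (h : EnergyAt p Ω Q₀ DQ₀ Qt H t G) :
    ∫ x in Ω, (p.L₁ * gradSq G x + (p.L₂ + p.L₃) * divSq G x
        + 2 * (bulk p (timePrimitive Q₀ Qt t x) + p.A₀))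
      = (∫ x in Ω, (p.L₁ * gradSq G x + (p.L₂ + p.L₃) * divSq G x))
        + 2 * ∫ x in Ω, (bulk p (timePrimitive Q₀ Qt t x) + p.A₀) := by
  rw [integral_add (integral_elastic_energy h.grad.memLp_grad _ _).1 (h.integrable.const_mul 2),
    integral_const_mul]

lemma ReformulatedData.ae_energyAt (h : ReformulatedData p Ω T Q₀ DQ₀ Q r DQ Qt H)
    (hp : p.Admissible d) (hΩ : IsOpen Ω) (hΩv : volume Ω < ⊤) (hT : 0 < T)
    (hQ₀s : ∀ x ∈ Ω, SymTraceFree (Q₀ x))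
    (hQ₀ : ∀ i j, MemLp (fun x => Q₀ x i j) 2 (volume.restrict Ω)) :
    ∀ᵐ t ∂(volume.restrict (Ioo 0 T)), EnergyAt p Ω Q₀ DQ₀ Qt H t (DQ t) := by
  obtain ⟨C, hC⟩ := h.linftyH1.bound
  obtain ⟨C', hC'⟩ := h.linftyL2.bound
  have hV := (ae_ae_of_ae_restrict_prod (s := fun t x => Q t x = timePrimitive Q₀ Qt t x)
    (h.Q_eq_timePrimitive hp hΩ hΩv hT hQ₀).1).1
  have hr := (ae_ae_of_ae_restrict_prod (s := fun t x => r t x = rFun p (Q t x))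
    (h.r_eq_rFun hp hΩ hΩv hT hQ₀s hQ₀)).1
  filter_upwards [hC, hC', hV, hr, h.energy, ae_restrict_mem measurableSet_Ioo]
    with t h1 h2 h3 h4 h5 ht
  have hsq : ∀ᵐ x ∂(volume.restrict Ω),
      r t x ^ 2 = 2 * (bulk p (timePrimitive Q₀ Qt t x) + p.A₀) := by
    filter_upwards [h3, h4, ae_restrict_mem hΩ.measurableSet] with x h3 h4 hx
    rw [h4, rFun_sq hp (h.symTraceFree t (Ioo_subset_Icc_self ht) x hx), h3]
  refine ⟨h1.1.congr h3, ?_, ?_⟩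
  · refine (h2.1.integrable_sq.const_mul (1 / 2)).congr ?_
    filter_upwards [hsq] with x hx
    rw [hx]; ring
  · refine le_trans (le_of_eq ?_) h5
    congr 1
    refine integral_congr_ae ?_
    filter_upwards [hsq] with x hx
    rw [hx]

/-- Continuity in `L²` implies weak continuity against bounded functions; it is used to pass to the
limit in the identity that defines the weak gradient. -/
lemma tendsto_integral_timePrimitive_mul (hT : 0 < T) (hΩv : volume Ω < ⊤) (hQt : IsL2ST Ω T Qt)
    (hQ₀ : ∀ i j, MemLp (fun x => Q₀ x i j) 2 (volume.restrict Ω)) {s : ℝ} (hs : s ∈ Icc 0 T)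
    {v : Space d → ℝ} (hv : Continuous v) {C : ℝ} (hC : ∀ x, ‖v x‖ ≤ C) (i j : Fin d) :
    Tendsto (fun t => ∫ x in Ω, timePrimitive Q₀ Qt t x i j * v x) (𝓝[Icc 0 T] s)
      (𝓝 (∫ x in Ω, timePrimitive Q₀ Qt s x i j * v x)) := by
  have : IsFiniteMeasure (volume.restrict Ω) := ⟨by simpa using hΩv⟩
  set V := timePrimitive Q₀ Qt
  have hV := fun {t} ht i j => memLp_timePrimitive (t := t) hQt hQ₀ ht i j
  have hvm : ∀ {f : Space d → ℝ}, MemLp f 2 (volume.restrict Ω) →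
      MemLp (fun x => f x * v x) 2 (volume.restrict Ω) := fun {f} hf => by
    refine (hf.const_mul C).of_le (hf.1.mul hv.aestronglyMeasurable) (Eventually.of_forall ?_)
    intro x
    rw [norm_mul, norm_mul, mul_comm]
    gcongr
    exact (hC x).trans (le_abs_self _)
  set K := (volume.restrict Ω).real univ * C ^ 2
  have hlim := (tendsto_timePrimitive (Q₀ := Q₀) hT hΩv hQt hs).const_mul K
  rw [mul_zero] at hlim
  rw [tendsto_iff_norm_sub_tendsto_zero]
  have hsq : Tendsto (fun t => Real.sqrt (K * ∫ x in Ω, dot (V t x - V s x) (V t x - V s x)))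
      (𝓝[Icc 0 T] s) (𝓝 0) := by
    have := (Real.continuous_sqrt.tendsto 0).comp hlim
    rwa [Real.sqrt_zero] at this
  refine squeeze_zero' (Eventually.of_forall fun _ => norm_nonneg _) ?_ hsq
  filter_upwards [self_mem_nhdsWithin] with t ht
  have hdiff : MemLp (fun x => V t x i j - V s x i j) 2 (volume.restrict Ω) :=
    (hV ht i j).sub (hV hs i j)
  rw [← integral_sub ((hvm (hV ht i j)).integrable (by norm_num))
    ((hvm (hV hs i j)).integrable (by norm_num))]
  refine Real.le_sqrt_of_sq_le ?_
  rw [Real.norm_eq_abs, sq_abs]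
  have h1 := sq_integral_le (hvm hdiff)
  simp only [sub_mul] at h1
  refine h1.trans ?_
  rw [mul_assoc]
  gcongr
  rw [← integral_const_mul]
  have h2 := (hvm hdiff).integrable_sq
  simp only [sub_mul] at h2
  refine integral_mono h2 ((integrable_dot (fun i j => (hV ht i j).sub (hV hs i j))
    fun i j => (hV ht i j).sub (hV hs i j)).const_mul _) fun x => ?_
  simp only
  have h3 : v x ^ 2 ≤ C ^ 2 := by
    rw [← sq_abs (v x)]; exact pow_le_pow_left₀ (abs_nonneg _) (hC x) 2
  have h4 := sq_entry_le_dot_self (V t x - V s x) i j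
  rw [Matrix.sub_apply] at h4
  calc (V t x i j * v x - V s x i j * v x) ^ 2 = v x ^ 2 * (V t x i j - V s x i j) ^ 2 := by ring
    _ ≤ _ := by gcongr

/-- Times satisfying the inequality are dense. Approaching `t` through them, the energy bound makes
the gradients bounded in `L²`, a weak limit serves as gradient at time `t`, and each energy term
passes to the limit with the right sign. -/
lemma exists_energyAt (hp : p.Admissible d) (hΩv : volume Ω < ⊤) (hT : 0 < T)
    (hQt : IsL2ST Ω T Qt) (hH : IsL2ST Ω T H)
    (hQ₀ : ∀ i j, MemLp (fun x => Q₀ x i j) 2 (volume.restrict Ω))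
    (hst : ∀ᵐ x ∂(volume.restrict Ω), ∀ t ∈ Icc 0 T, SymTraceFree (timePrimitive Q₀ Qt t x))
    (hae : ∀ᵐ t ∂(volume.restrict (Ioo 0 T)), EnergyAt p Ω Q₀ DQ₀ Qt H t (DQ t))
    {t : ℝ} (ht : t ∈ Icc 0 T) : ∃ G, EnergyAt p Ω Q₀ DQ₀ Qt H t G := by
  have : IsFiniteMeasure (volume.restrict Ω) := ⟨by simpa using hΩv⟩
  obtain ⟨τ, hτ, hτt⟩ := mem_closure_iff_seq_limit.1 (Icc_subset_closure_of_ae hT hae ht)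
  have hτI : ∀ n, τ n ∈ Icc 0 T := fun n => Ioo_subset_Icc_self (hτ n).1
  have hτw : Tendsto τ atTop (𝓝[Icc 0 T] t) :=
    tendsto_nhdsWithin_iff.2 ⟨hτt, Eventually.of_forall hτI⟩
  set V := timePrimitive Q₀ Qt with hVdef
  set E₀ := ∫ x in Ω, (p.L₁ * gradSq DQ₀ x + (p.L₂ + p.L₃) * divSq DQ₀ x
          + (rFun p (Q₀ x)) ^ 2) with hE₀
  set D : ℝ → ℝ := fun t => ∫ q in Ioo 0 t ×ˢ Ω, dot (H q.1 q.2) (H q.1 q.2) with hD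
  set B : (Fin d → Space d → Mat d) → ℝ := fun G =>
    ∫ x in Ω, (p.L₁ * gradSq G x + (p.L₂ + p.L₃) * divSq G x) with hB
  have hL₁ := hp.L₁_pos
  have hL : 0 < p.L₂ + p.L₃ := add_pos hp.L₂_pos hp.L₃_pos
  have hD0 : ∀ t, 0 ≤ D t := fun t => integral_nonneg fun q => dot_self_nonneg _
  have hen : ∀ n, 1 / 2 * (B (DQ (τ n)) + 2 * ∫ x in Ω, (bulk p (V (τ n) x) + p.A₀))
      ≤ 1 / 2 * E₀ - p.M * D (τ n) := fun n => by
    have := (hτ n).2.energy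
    rwa [(hτ n).2.integral_eq] at this
  have hf0 : ∀ᵐ x ∂(volume.restrict Ω), ∀ n, 0 ≤ bulk p (V (τ n) x) + p.A₀ := by
    filter_upwards [hst] with x hx n using (hp.r_pos _ (hx _ (hτI n))).le
  have hfi : ∀ n, 0 ≤ ∫ x in Ω, (bulk p (V (τ n) x) + p.A₀) := fun n =>
    integral_nonneg_of_ae (hf0.mono fun x hx => hx n)
  have hMD : ∀ n, 0 ≤ p.M * D (τ n) := fun n => mul_nonneg hp.M_pos.le (hD0 _)
  have hBsum : ∀ n k i j, p.L₁ * ∫ x in Ω, DQ (τ n) k x i j ^ 2 ≤ B (DQ (τ n)) := by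
    intro n k i j
    have hm := (hτ n).2.grad.memLp_grad
    rw [← integral_const_mul]
    refine integral_mono ((hm k i j).integrable_sq.const_mul _)
      (integral_elastic_energy hm _ _).1 fun x => ?_
    have h1 := sq_entry_le_gradSq (DQ (τ n)) x k i j
    have h2 : 0 ≤ divSq (DQ (τ n)) x := Finset.sum_nonneg fun _ _ => sq_nonneg _
    have h3 := mul_le_mul_of_nonneg_left h1 hL₁.le
    have h4 := mul_nonneg hL.le h2
    simp only
    linarith
  have hB0 : ∀ n, 0 ≤ B (DQ (τ n)) := fun n => integral_nonneg fun x => by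
    have h1 := gradSq_nonneg (DQ (τ n)) x
    have h2 : 0 ≤ divSq (DQ (τ n)) x := Finset.sum_nonneg fun _ _ => sq_nonneg _
    simp only [Pi.zero_apply]
    positivity
  have hgb : ∀ k i j n, ∫ x in Ω, DQ (τ n) k x i j ^ 2 ≤ E₀ / p.L₁ := fun k i j n => by
    rw [le_div_iff₀ hL₁]
    have h1 := hBsum n k i j
    have h2 := hen n
    have h3 := hfi n
    have h4 := hMD n
    linarith
  have hfb : ∀ n, ∫ x in Ω, (bulk p (V (τ n) x) + p.A₀) ≤ 1 / 2 * E₀ := fun n => by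
    have h2 := hen n
    have h3 := hB0 n
    have h4 := hMD n
    linarith
  -- One fixed ultrafilter gives weak limits of all entries simultaneously, so that the limits
  -- combine in the divergence.
  have hG := fun k i j => exists_weak_limit (hyperfilter ℕ)
    (fun n => (hτ n).2.grad.memLp_grad k i j) (hgb k i j)
  choose G₀ hG₀ hGlim using hG
  let G : Fin d → Space d → Mat d := fun k x => Matrix.of fun i j => G₀ k i j x
  have hle : ((hyperfilter ℕ : Ultrafilter ℕ) : Filter ℕ) ≤ atTop := Nat.hyperfilter_le_atTop
  have hlimx : ∀ᵐ x ∂(volume.restrict Ω),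
      Tendsto (fun n => bulk p (V (τ n) x) + p.A₀) atTop (𝓝 (bulk p (V t x) + p.A₀)) := by
    filter_upwards [ae_intervalIntegrable hT hΩv hQt] with x hx
    have hc : Tendsto (fun n => V (τ n) x) atTop (𝓝 (V t x)) :=
      ((continuousOn_timePrimitive (Q₀ := Q₀) hT hx) t ht).tendsto.comp hτw
    exact (((continuous_bulk p).tendsto _).comp hc).add_const _
  obtain ⟨hint, m₁, hm₁, hm₁t⟩ := exists_minorant_integral (fun n => (hτ n).2.integrable) hf0 hfb
    hlimx
  obtain ⟨m₂, hm₂, hm₂t⟩ := exists_minorant_elastic_energy (l := (hyperfilter ℕ : Filter ℕ))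
    (G := G) (fun n => (hτ n).2.grad.memLp_grad) hG₀ (fun k i j v hv => hGlim k i j v hv)
    hL₁.le hL.le
  have hgrad : HasH1Gradient Ω (V t) G := by
    refine ⟨memLp_timePrimitive hQt hQ₀ ht, hG₀, fun k i j φ hφ => ?_⟩
    obtain ⟨hc, C, hC⟩ := exists_pd_bound hφ k
    obtain ⟨C', hC'⟩ := hφ.exists_bound
    have h1 : Tendsto (fun n => ∫ x in Ω, V (τ n) x i j * pd k φ x) (hyperfilter ℕ : Filter ℕ)
        (𝓝 (∫ x in Ω, V t x i j * pd k φ x)) :=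
      ((tendsto_integral_timePrimitive_mul hT hΩv hQt hQ₀ ht hc hC i j).comp hτw).mono_left hle
    have h2 := (hGlim k i j φ (MemLp.of_bound hφ.1.continuous.aestronglyMeasurable C'
      (Eventually.of_forall hC'))).neg
    -- Both sides of the integration by parts formula at time `τ n` converge, so the formula holds
    -- in the limit and identifies `G` as the weak gradient.
    refine tendsto_nhds_unique h1 (h2.congr fun n => ?_)
    exact ((hτ n).2.grad.weak k i j φ hφ).symm
  refine ⟨G, hgrad, hint, ?_⟩
  rw [integral_add (integral_elastic_energy hgrad.memLp_grad _ _).1 (Integrable.const_mul hint 2),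
    integral_const_mul]
  have hDc : Tendsto (fun n => D (τ n)) (hyperfilter ℕ : Filter ℕ) (𝓝 (D t)) :=
    (((continuousOn_setIntegral_Ioo_prod hT (integrable_dot hH hH)) t ht).tendsto.comp hτw).mono_left
      hle
  have hleft := ((hm₂t.add ((hm₁t.mono_left hle).const_mul 2))).const_mul (1 / 2)
  have hright := (hDc.const_mul p.M).const_sub (1 / 2 * E₀)
  refine le_of_tendsto_of_tendsto hleft hright (Eventually.of_forall fun n => ?_)
  refine le_trans ?_ (hen n)
  have h1 := hm₁ n
  have h2 := hm₂ n
  simp only [hB]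
  linarith

end

/-! ### The Q-tensor flow -/

section

variable {p : Params} {Ω : Set (Space d)} {T : ℝ} {Q₀ : Space d → Mat d}
  {DQ₀ : Fin d → Space d → Mat d} {Q Q' : ℝ → Space d → Mat d} {r : ℝ → Space d → ℝ}
  {DQ DQ' : ℝ → Fin d → Space d → Mat d} {Qt H : ℝ → Space d → Mat d}

lemma ae_restrict_prod_of_ae {s : ℝ → Prop} (h : ∀ᵐ t ∂(volume.restrict (Ioo 0 T)), s t) :
    ∀ᵐ q ∂(volume : Measure (ℝ × Space d)).restrict (Ioo 0 T ×ˢ Ω), s q.1 := by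
  rw [volume_restrict_prod]
  exact Measure.quasiMeasurePreserving_fst.ae h

lemma elastic_congr {φ : ℝ → Space d → Mat d} {t : ℝ} (h : DQ' t = DQ t) (x : Space d) :
    elastic p DQ' φ t x = elastic p DQ φ t x := by
  simp only [elastic, h]

lemma IsLinftyH1.congr (h : IsLinftyH1 Ω T Q DQ)
    (hQ : ∀ᵐ q ∂(volume : Measure (ℝ × Space d)).restrict (Ioo 0 T ×ˢ Ω), Q' q.1 q.2 = Q q.1 q.2)
    (hD : ∀ᵐ t ∂(volume.restrict (Ioo 0 T)), DQ' t = DQ t) : IsLinftyH1 Ω T Q' DQ' where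
  meas i j := (h.meas i j).congr (hQ.mono fun q hq => by simp only [hq])
  meas_grad k i j := (h.meas_grad k i j).congr
    ((ae_restrict_prod_of_ae hD).mono fun q hq => by simp only [hq])
  bound := by
    obtain ⟨C, hC⟩ := h.bound
    refine ⟨C, ?_⟩
    filter_upwards [hC, hD, (ae_ae_of_ae_restrict_prod (s := fun t x => Q' t x = Q t x) hQ).1]
      with t h1 h2 h3
    rw [h2]
    refine ⟨h1.1.congr (h3.mono fun x hx => hx.symm), le_trans (le_of_eq ?_) h1.2⟩
    exact integral_congr_ae (h3.mono fun x hx => by simp only [hx])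

lemma HasL2TimeDeriv.congr (h : HasL2TimeDeriv Ω T Q Qt)
    (hQ : ∀ᵐ q ∂(volume : Measure (ℝ × Space d)).restrict (Ioo 0 T ×ˢ Ω),
      Q' q.1 q.2 = Q q.1 q.2) : HasL2TimeDeriv Ω T Q' Qt where
  memLp := h.memLp
  weak i j ψ hψ := by
    rw [← h.weak i j ψ hψ]
    exact integral_congr_ae (hQ.mono fun q hq => by simp only [hq])

lemma integrable_dot_test {U : Set (ℝ × Space d)} {μ : Measure (ℝ × Space d)}
    {R : ℝ × Space d → Mat d} (hR : ∀ i j, Integrable (fun q => R q i j) μ)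
    {φ : ℝ → Space d → Mat d} (hφ : IsTestSTMat U φ) :
    Integrable (fun q => dot (R q) (φ q.1 q.2)) μ := by
  refine integrable_finsetSum _ fun i _ => integrable_finsetSum _ fun j _ => ?_
  obtain ⟨hs, hc, -⟩ := hφ i j
  obtain ⟨C, hC⟩ := hc.exists_bound_of_continuous hs.continuous
  exact (hR i j).mul_bdd (c := C) hs.continuous.aestronglyMeasurable (Eventually.of_forall hC)

lemma ReformulatedData.isWeakSolutionFlow (h : ReformulatedData p Ω T Q₀ DQ₀ Q r DQ Qt H)
    (hp : p.Admissible d) (hΩ : IsOpen Ω) (hΩv : volume Ω < ⊤) (hT : 0 < T)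
    (hQ₀s : ∀ x ∈ Ω, SymTraceFree (Q₀ x)) (hQ₀ : HasH1Gradient Ω Q₀ DQ₀)
    (hQ' : IsContinuousRepresentative Ω T Q Q') : IsWeakSolutionFlow p Ω T Q₀ DQ₀ Q' := by
  classical
  have : IsFiniteMeasure (volume.restrict Ω) := ⟨by simpa using hΩv⟩
  have hst := h.ae_symTraceFree_timePrimitive hp hΩ hΩv hT hQ₀.memLp
  have hae := h.ae_energyAt hp hΩ hΩv hT hQ₀s hQ₀.memLp
  have hex : ∀ t ∈ Icc 0 T, ∃ G, EnergyAt p Ω Q₀ DQ₀ Qt H t G := fun t ht =>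
    exists_energyAt hp hΩv hT h.timeDeriv.memLp h.driving.memLp hQ₀.memLp hst hae ht
  -- The choice keeps `DQ t` whenever it already works, which is the case at a.e. time. The new
  -- gradient thus inherits joint measurability, and space-time integrals do not change.
  have hex' : ∀ t, ∃ G, (t ∈ Icc 0 T → EnergyAt p Ω Q₀ DQ₀ Qt H t G) ∧
      (EnergyAt p Ω Q₀ DQ₀ Qt H t (DQ t) → G = DQ t) := fun t => by
    by_cases h1 : EnergyAt p Ω Q₀ DQ₀ Qt H t (DQ t)
    · exact ⟨DQ t, fun _ => h1, fun _ => rfl⟩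
    · by_cases h2 : t ∈ Icc 0 T
      · obtain ⟨G, hG⟩ := hex t h2
        exact ⟨G, fun _ => hG, fun h3 => absurd h3 h1⟩
      · exact ⟨DQ t, fun h3 => absurd h3 h2, fun _ => rfl⟩
  choose DQ' hDQ' hDQeq using hex'
  have hD : ∀ᵐ t ∂(volume.restrict (Ioo 0 T)), DQ' t = DQ t := hae.mono fun t ht => hDQeq t ht
  have hDq : ∀ᵐ q ∂(volume : Measure (ℝ × Space d)).restrict (Ioo 0 T ×ˢ Ω), DQ' q.1 = DQ q.1 :=
    ae_restrict_prod_of_ae hD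
  have hS : ∀ᵐ q ∂(volume : Measure (ℝ × Space d)).restrict (Ioo 0 T ×ˢ Ω),
      S p (Q' q.1 q.2) = r q.1 q.2 • P p (Q q.1 q.2) := by
    filter_upwards [hQ'.ae_eq, h.r_eq_rFun hp hΩ hΩv hT hQ₀s hQ₀.memLp, h.ae_symTraceFree hΩ]
      with q h1 h2 h3
    rw [h1, h2, rFun_smul_P hp h3]
  have hrepr : ∀ t ∈ Icc 0 T, ∀ᵐ x ∂(volume.restrict Ω), Q' t x = timePrimitive Q₀ Qt t x :=
    fun t ht => h.representative_eq hp hΩ hΩv hT hQ₀.memLp hQ' ht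
  have hel : ∀ φ : ℝ → Space d → Mat d, ∫ q in Ioo 0 T ×ˢ Ω, elastic p DQ' φ q.1 q.2
      = ∫ q in Ioo 0 T ×ˢ Ω, elastic p DQ φ q.1 q.2 := fun φ =>
    integral_congr_ae (hDq.mono fun q hq => elastic_congr hq q.2)
  have hre : ∀ φ : ℝ → Space d → Mat d, ∫ q in Ioo 0 T ×ˢ Ω, dot (S p (Q' q.1 q.2)) (φ q.1 q.2)
      = ∫ q in Ioo 0 T ×ˢ Ω, dot (r q.1 q.2 • P p (Q q.1 q.2)) (φ q.1 q.2) := fun φ =>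
    integral_congr_ae (hS.mono fun q hq => by simp only [hq])
  refine ⟨DQ', Qt, H, hQ'.symTraceFree, h.linftyH1.congr hQ'.ae_eq hD,
    h.timeDeriv.congr hQ'.ae_eq, fun φ hφ => ?_, fun φ hφ => ?_, ⟨h.driving.memLp, fun φ hφ => ?_⟩,
    fun t ht => ?_⟩
  · refine (integrable_dot_test (h.integrable_reaction hp hΩ hΩv) hφ).congr ?_
    exact hS.mono fun q hq => by simp only [hq]
  · have e1 : ∫ q in Ioo 0 T ×ˢ Ω, dot (Q' q.1 q.2) (tdMat φ q.1 q.2)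
        = ∫ q in Ioo 0 T ×ˢ Ω, dot (Q q.1 q.2) (tdMat φ q.1 q.2) :=
      integral_congr_ae (hQ'.ae_eq.mono fun q hq => by simp only [hq])
    -- The final value of `Q` is not determined by its a.e. class; it is the weak equation that
    -- forces it to equal the primitive at `T`, as does continuity for `Q'`.
    have e2 : ∫ x in Ω, dot (Q' T x) (φ T x) = ∫ x in Ω, dot (Q T x) (φ T x) := by
      refine integral_congr_ae ?_
      filter_upwards [hrepr T ⟨hT.le, le_rfl⟩, (h.Q_eq_timePrimitive hp hΩ hΩv hT hQ₀.memLp).2]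
        with x h1 h2
      rw [h1, h2]
    rw [hel, hre, e1, e2, h.equation_Q φ hφ]
  · rw [hel, hre, h.driving.weak φ hφ]
  · have hE := hDQ' t ht
    -- The primitive at time `0` is `Q₀`, so integrability of its bulk energy follows from the case
    -- `t = 0`.
    obtain ⟨G₀, hG₀⟩ := hex 0 ⟨le_rfl, hT.le⟩
    have hb₀ : IntegrableOn (fun x => bulk p (Q₀ x)) Ω := by
      have h1 := hG₀.integrable
      simp only [timePrimitive_zero] at h1
      exact (h1.sub (integrable_const p.A₀)).congr (Eventually.of_forall fun x => by simp)
    have hb : IntegrableOn (fun x => bulk p (timePrimitive Q₀ Qt t x)) Ω :=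
      (hE.integrable.sub (integrable_const p.A₀)).congr (Eventually.of_forall fun x => by simp)
    -- Separates the constant `2 A₀ |Ω|`, which appears on both sides of the inequality and cancels.
    have split : ∀ {u f : Space d → ℝ}, IntegrableOn u Ω → IntegrableOn f Ω →
        ∫ x in Ω, (u x + 2 * (f x + p.A₀))
          = (∫ x in Ω, (u x + 2 * f x)) + ∫ _x in Ω, 2 * p.A₀ := fun {u f} hu hf => by
      have h1 : IntegrableOn (fun x => u x + 2 * f x) Ω := hu.add (hf.const_mul 2)
      rw [← integral_add h1 (integrable_const _)]
      exact integral_congr_ae (Eventually.of_forall fun x => by simp only; ring)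
    have hr₀ : ∫ x in Ω, (p.L₁ * gradSq DQ₀ x + (p.L₂ + p.L₃) * divSq DQ₀ x + (rFun p (Q₀ x)) ^ 2)
        = ∫ x in Ω, (p.L₁ * gradSq DQ₀ x + (p.L₂ + p.L₃) * divSq DQ₀ x
          + 2 * (bulk p (Q₀ x) + p.A₀)) := by
      refine setIntegral_congr_fun hΩ.measurableSet fun x hx => ?_
      simp only [rFun_sq hp (hQ₀s x hx)]
    have hen := hE.energy
    rw [hr₀, split (integral_elastic_energy hE.grad.memLp_grad _ _).1 hb,
      split (integral_elastic_energy hQ₀.memLp_grad _ _).1 hb₀] at hen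
    have heq := hrepr t ht
    refine ⟨hE.grad.congr (heq.mono fun x hx => hx.symm), hb.congr ?_, ?_⟩
    · exact heq.mono fun x hx => by simp only [hx]
    · have h1 : ∫ x in Ω, (p.L₁ * gradSq (DQ' t) x + (p.L₂ + p.L₃) * divSq (DQ' t) x
          + 2 * bulk p (Q' t x)) = ∫ x in Ω, (p.L₁ * gradSq (DQ' t) x
          + (p.L₂ + p.L₃) * divSq (DQ' t) x + 2 * bulk p (timePrimitive Q₀ Qt t x)) :=
        integral_congr_ae (heq.mono fun x hx => by simp only [hx])
      rw [h1]
      linarith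

end

end QTensor

end

open QTensor
theorem mainTheorem3 (d : ℕ) (hd : d = 2 ∨ d = 3)
    (p : Params) (hp : p.Admissible d)
    (Ω : Set (Space d)) (hΩ : IsOpen Ω) (hΩb : Bornology.IsBounded Ω)
    (T : ℝ) (hT : 0 < T)
    (Q₀ : Space d → Mat d) (DQ₀ : Fin d → Space d → Mat d)
    (hQ₀ : ∀ x ∈ Ω, SymTraceFree (Q₀ x)) (hQ₀' : HasH10Gradient Ω Q₀ DQ₀)
    (Q : ℝ → Space d → Mat d) (g : ℝ → Space d → ℝ)
    (h : IsWeakSolutionReformulated p Ω T Q₀ DQ₀ Q g) :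
    (∀ ψ : ℝ → Space d → ℝ, IsTestST (Ioo 0 T ×ˢ Ω) ψ →
      ∫ q in Ioo 0 T ×ˢ Ω, g q.1 q.2 * ψ q.1 q.2
        = ∫ q in Ioo 0 T ×ˢ Ω, rFun p (Q q.1 q.2) * ψ q.1 q.2) ∧
    (∃ Q' : ℝ → Space d → Mat d, IsContinuousRepresentative Ω T Q Q') ∧
    (∀ Q' : ℝ → Space d → Mat d, IsContinuousRepresentative Ω T Q Q' →
      IsWeakSolutionFlow p Ω T Q₀ DQ₀ Q') := by
  obtain ⟨DQ, Qt, H, h⟩ := h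
  have hΩv : volume Ω < ⊤ := hΩb.measure_lt_top
  refine ⟨fun ψ _ => ?_, h.exists_isContinuousRepresentative hp hΩ hΩv hT hQ₀'.1.memLp,
    fun Q' hQ' => h.isWeakSolutionFlow hp hΩ hΩv hT hQ₀ hQ₀'.1 hQ'⟩
  exact integral_congr_ae ((h.r_eq_rFun hp hΩ hΩv hT hQ₀ hQ₀'.1.memLp).mono fun q hq => by
    simp only [hq])
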